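/- Let $q\ge 5$ be a prime power with $q\not\equiv 0\pmod 3$. Let $\mathcal C=\{P(t): t\in\mathbb F_q\cup\{\infty\}\}$ be the twisted cubic in $\mathrm{PG}(3,q)$, where $P(t)=(t^3,t^2,t,1)$ and $P(\infty)=(1,0,0,0)$. Let $\Gamma$ be the set of its $q+1$ osculating planes: the plane at $P(t)$ has equation $x_0-3tx_1+3t^2x_2-t^3x_3=0$, the plane at $P(\infty)$ has equation $x_3=0$. Let $G_q$ be the group of projectivities fixing $\mathcal C$. Let $\mathfrak A$ be the null polarity, which sends the point $(x_0,x_1,x_2,x_3)$ to the plane $x_3X_0-3x_2X_1+3x_1X_2-x_0X_3=0$ and a line to the intersection of the images of its points. Lines are divided into the classes $\mathcal O_\lambda$: $\mathrm{RC}$ (real chords: lines through two distinct points of $\mathcal C$), $\mathrm{RA}$ (real axes: intersections of two distinct planes of $\Gamma$), $\mathrm T$ (tangents to $\mathcal C$), $\mathrm{IC}$, $\mathrm{IA}$ (imaginary chords and axes: lines of $\mathrm{PG}(3,q)$ through two conjugate points $P(t),P(t^q)$, respectively being the intersection of the osculating planes at two such points, $t\in\mathbb F_{q^2}\setminus\mathbb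 F_q$), $\mathrm{U\Gamma}$ (non-tangent lines with exactly one point on $\mathcal C$, in a plane of $\Gamma$), $\mathrm{Un\Gamma}$ (lines with exactly one point on $\mathcal C$, in no plane of $\Gamma$), $\mathrm{E\Gamma}$ and $\mathrm{En\Gamma}$ (lines with no point on $\mathcal C$, other than chords and axes, which lie, respectively do not lie, in a plane of $\Gamma$). Plane types $\pi$, with $\mathcal N_\pi$ the set of $\pi$-planes: $\Gamma$ (the planes of $\Gamma$); $d_{\mathcal C}$ (exactly $d$ points of $\mathcal C$; $d=0,2,3$); $\overline{1_{\mathcal C}}$ (not in $\Gamma$, exactly one point of $\mathcal C$). Point types $\mathfrak p$, with $\mathcal M_{\mathfrak p}$ the set of $\mathfrak p$-points: $\mathcal C$; $\mu_\Gamma$ (off $\mathcal C$, on exactly $\mu$ osculating planes; $\mu=0,1,3$); $\mathrm T$, $\mathrm{RC}$ (off $\mathcal C$ and on a tangent, respectively on a real chord); $\mathrm{IC}$ (on an imaginary chord). Then the following holds. 1. $\mathfrak A$ sends every $G_q$-orbit of points to a $G_q$-orbit of planes, and every $G_q$-orbit of lines to a $G_q$-orbit of lines. 2. $\mathcal M_{\mathcal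 C}\mathfrak A=\mathcal N_\Gamma$, $\mathcal M_{\mathrm T}\mathfrak A=\mathcal N_{2_{\mathcal C}}$, $\mathcal M_{3_\Gamma}\mathfrak A=\mathcal N_{3_{\mathcal C}}$, $\mathcal M_{1_\Gamma}\mathfrak A=\mathcal N_{\overline{1_{\mathcal C}}}$, $\mathcal M_{0_\Gamma}\mathfrak A=\mathcal N_{0_{\mathcal C}}$. Write $\pi(\mathfrak p)$ for the plane type with $\mathcal M_{\mathfrak p}\mathfrak A=\mathcal N_{\pi(\mathfrak p)}$, whenever there is one; in that case $\mathcal M_{\mathfrak p}$ and $\mathcal N_{\pi(\mathfrak p)}$ are $G_q$-orbits. 3. Each class $\mathcal O_\lambda$ is a union of $G_q$-orbits, and $\mathcal O_{\widetilde\lambda}\mathfrak A=\mathcal O_{\lambda(\widetilde\lambda)}$, where $\lambda(\cdot)$ interchanges $\mathrm{RC}$ and $\mathrm{RA}$, $\mathrm{IC}$ and $\mathrm{IA}$, $\mathrm{Un\Gamma}$ and $\mathrm{E\Gamma}$, and fixes $\mathrm T$, $\mathrm{U\Gamma}$ and $\mathrm{En\Gamma}$. Every $G_q$-orbit contained in $\mathcal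 O_{\mathrm{U\Gamma}}$ is mapped onto itself by $\mathfrak A$. For every $G_q$-orbit $\mathcal O_{\widetilde\lambda_j}\subseteq\mathcal O_{\widetilde\lambda}$, the $G_q$-orbit $\mathcal O_{\lambda_j(\widetilde\lambda_j)}:=\mathcal O_{\widetilde\lambda_j}\mathfrak A$ is contained in $\mathcal O_{\lambda(\widetilde\lambda)}$. 4. For every point type $\mathfrak p$ for which $\pi(\mathfrak p)$ exists and every line type $\widetilde\lambda$, $$\mathrm P_{\mathfrak p,\widetilde\lambda}=\Pi_{\pi(\mathfrak p),\lambda(\widetilde\lambda)},\qquad \mathrm L_{\widetilde\lambda,\mathfrak p}=\Lambda_{\lambda(\widetilde\lambda),\pi(\mathfrak p)},$$ and for every $G_q$-orbit $\mathcal O_{\widetilde\lambda_j}\subseteq\mathcal O_{\widetilde\lambda}$, $$\mathrm P_{\mathfrak p,\widetilde\lambda_j}=\Pi_{\pi(\mathfrak p),\lambda_j(\widetilde\lambda_j)},\qquad \mathrm L_{\widetilde\lambda_j,\mathfrak p}=\Lambda_{\lambda_j(\widetilde\lambda_j),\pi(\mathfrak p)}.$$ Here $\mathrm P_{\mathfrak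 p,\lambda}$ ($\Pi_{\pi,\lambda}$) is the average number of $\mathfrak p$-points on (of $\pi$-planes through) a line of $\mathcal O_\lambda$; $\mathrm P_{\mathfrak p,\lambda_j}$ ($\Pi_{\pi,\lambda_j}$) is the exact number of $\mathfrak p$-points on (of $\pi$-planes through) each line of the orbit $\mathcal O_{\lambda_j}$; $\mathrm L_{\lambda,\mathfrak p}$, $\mathrm L_{\lambda_j,\mathfrak p}$ ($\Lambda_{\lambda,\pi}$, $\Lambda_{\lambda_j,\pi}$) are the exact numbers of lines of $\mathcal O_\lambda$, $\mathcal O_{\lambda_j}$ through each $\mathfrak p$-point (in each $\pi$-plane). It is part of the claim that these exact numbers do not depend on the line, point or plane chosen. Thus every entry of the point-line incidence tables, for these point types and for all line classes and line orbits, equals the entry of the plane-line incidence table at the position given by 2 and 3. -/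

import Mathlib

namespace TwistedCubic

noncomputable section

/-- Subspaces of `PG(3,K)`, as linear subspaces of `K⁴`: points, lines and planes are those of
vector dimension `1`, `2`, `3`, and incidence is inclusion `≤`. -/
abbrev Subsp (K : Type*) [Field K] := Submodule K (Fin 4 → K)

/-- The plane `π(c₀,c₁,c₂,c₃)` with equation `c₀x₀ + c₁x₁ + c₂x₂ + c₃x₃ = 0`
(all of `K⁴` when `c = 0`). -/
def plane {K : Type*} [Field K] (c : Fin 4 → K) : Subsp K where
  carrier := {x | c 0 * x 0 + c 1 * x 1 + c 2 * x 2 + c 3 * x 3 = 0}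
  zero_mem' := by simp
  add_mem' := by
    intro x y hx hy
    simp only [Set.mem_ofPred_eq, Pi.add_apply] at *
    linear_combination hx + hy
  smul_mem' := by
    intro a x hx
    simp only [Set.mem_ofPred_eq, Pi.smul_apply, smul_eq_mul] at *
    linear_combination a * hx

/-- Coordinate vector of the point `P(t)`. The parameter ranges over `K ∪ {∞}`, written
`Option K` with `none` for `∞`. -/
def cubicVec {K : Type*} [Field K] : Option K → Fin 4 → K
  | some t => ![t ^ 3, t ^ 2, t, 1]
  | none => ![1, 0, 0, 0]

/-- The point `P(t)` of the twisted cubic. -/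
def cubicPoint {K : Type*} [Field K] (t : Option K) : Subsp K :=
  Submodule.span K {cubicVec t}

/-- The osculating plane at `P(t)`. -/
def oscPlane {K : Type*} [Field K] : Option K → Subsp K
  | some t => plane ![1, -3 * t, 3 * t ^ 2, -t ^ 3]
  | none => plane ![0, 0, 0, 1]

/-- The tangent at `P(t)`, spanned by the point and the derivative of the parametrization
(at `∞`: the line `x₂ = x₃ = 0`). -/
def tangentLine {K : Type*} [Field K] : Option K → Subsp K
  | some t => Submodule.span K {![t ^ 3, t ^ 2, t, 1], ![3 * t ^ 2, 2 * t, 1, 0]}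
  | none => Submodule.span K {![1, 0, 0, 0], ![0, 1, 0, 0]}

/-- The twisted cubic `𝒞`, as a set of points. -/
def cubic (F : Type*) [Field F] : Set (Subsp F) := Set.range cubicPoint

/-- The osculating developable `Γ`, as a set of planes. -/
def developable (F : Type*) [Field F] : Set (Subsp F) := Set.range oscPlane

/-- The null polarity: a point `P(x₀,x₁,x₂,x₃)` goes to the plane `π(x₃,-3x₂,3x₁,-x₀)`, and any
subspace goes to the intersection of the planes which are the images of its points. -/
def nullPolarity {F : Type*} [Field F] (W : Subsp F) : Subsp F :=
  ⨅ x ∈ W, plane ![x 3, -3 * x 2, 3 * x 1, -x 0]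

/-- `G_q`: the group of projectivities of `PG(3,F)` (collineations induced by invertible linear
maps) which fix the twisted cubic as a set. -/
def cubicGroup (F : Type*) [Field F] : Subgroup (Subsp F ≃o Subsp F) where
  carrier := {φ | (∃ e : (Fin 4 → F) ≃ₗ[F] (Fin 4 → F), ∀ W, φ W = W.map e.toLinearMap) ∧
    φ '' cubic F = cubic F}
  one_mem' := ⟨⟨LinearEquiv.refl F _, fun W => by simp⟩, by simp⟩
  mul_mem' := by
    rintro φ ψ ⟨⟨e, he⟩, hφ⟩ ⟨⟨f, hf⟩, hψ⟩
    refine ⟨⟨f.trans e, fun W => ?_⟩, ?_⟩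
    · rw [RelIso.mul_apply, he, hf, ← Submodule.map_comp]; rfl
    · have : (⇑(φ * ψ) : Subsp F → Subsp F) = φ ∘ ψ := rfl
      rw [this, Set.image_comp, hψ, hφ]
  inv_mem' := by
    rintro φ ⟨⟨e, he⟩, hφ⟩
    have h : ∀ W, φ (φ⁻¹ W) = W := fun W => RelIso.apply_inv_self φ W
    have h' : ∀ W, φ⁻¹ (φ W) = W := fun W => RelIso.inv_apply_self φ W
    refine ⟨⟨e.symm, fun W => ?_⟩, ?_⟩
    · apply φ.injective
      rw [h, he, ← Submodule.map_comp]
      simp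
    · conv_lhs => rw [← hφ]
      rw [Set.image_image]
      simp [h']

/-- `S` is an orbit under `G_q` of subspaces of vector dimension `k`
(`k = 1`: an orbit of points, `k = 2`: of lines, `k = 3`: of planes). -/
def IsOrbit {F : Type*} [Field F] (k : ℕ) (S : Set (Subsp F)) : Prop :=
  ∃ W : Subsp F, Module.finrank F W = k ∧ S = {U | ∃ φ ∈ cubicGroup F, U = φ W}

/-- Types of points, `q ≢ 0 (mod 3)`: `𝒞`, `0_Γ`, `1_Γ`, `3_Γ`, `T`, `RC`, `IC`. -/
inductive PointType
  | C | zeroΓ | oneΓ | threeΓ | T | RC | IC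

/-- Types of planes: `Γ`, `2_𝒞`, `3_𝒞`, `1̅_𝒞`, `0_𝒞`. -/
inductive PlaneType
  | Γ | twoC | threeC | oneC | zeroC

/-- Types of lines, `q ≢ 0 (mod 3)`: real chords, real axes, tangents, imaginary chords, imaginary
axes, `UΓ`, `UnΓ`, `EΓ`, `EnΓ`. -/
inductive LineType
  | RC | RA | T | IC | IA | UΓ | UnΓ | EΓ | EnΓ

/-- The subspace of `PG(3,K)` spanned by a subspace of `PG(3,F)`, for an extension `K` of `F`. -/
def extendScalars {F : Type*} (K : Type*) [Field F] [Field K] [Algebra F K] (W : Subsp F) : Subsp K :=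
  Submodule.span K ((fun v : Fin 4 → F => fun i => algebraMap F K (v i)) '' (W : Set (Fin 4 → F)))

/-- The element `t` of the algebraic closure of `F = F_q` lies in `F_{q²}` but not in `F_q`; its
conjugate is then `t ^ q`. -/
def IsImaginary {F : Type*} [Field F] (t : AlgebraicClosure F) : Prop :=
  t ^ (Nat.card F ^ 2) = t ∧ t ^ Nat.card F ≠ t

/-- Real chords: lines through two distinct points of `𝒞`. -/
def realChords (F : Type*) [Field F] : Set (Subsp F) :=
  {ℓ | ∃ s t : Option F, s ≠ t ∧ ℓ = cubicPoint s ⊔ cubicPoint t}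

/-- Real axes: intersections of two distinct planes of `Γ`. -/
def realAxes (F : Type*) [Field F] : Set (Subsp F) :=
  {ℓ | ∃ s t : Option F, s ≠ t ∧ ℓ = oscPlane s ⊓ oscPlane t}

/-- Tangents to `𝒞`. -/
def tangents (F : Type*) [Field F] : Set (Subsp F) := Set.range tangentLine

/-- Imaginary chords: lines of `PG(3,q)` through two conjugate points `P(t)`, `P(t^q)`. -/
def imaginaryChords (F : Type*) [Field F] : Set (Subsp F) :=
  {ℓ | Module.finrank F ℓ = 2 ∧ ∃ t : AlgebraicClosure F, IsImaginary t ∧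
    extendScalars (AlgebraicClosure F) ℓ =
      cubicPoint (some t) ⊔ cubicPoint (some (t ^ Nat.card F))}

/-- Imaginary axes: lines of `PG(3,q)` which are the intersection of two conjugate osculating
planes. -/
def imaginaryAxes (F : Type*) [Field F] : Set (Subsp F) :=
  {ℓ | Module.finrank F ℓ = 2 ∧ ∃ t : AlgebraicClosure F, IsImaginary t ∧
    extendScalars (AlgebraicClosure F) ℓ =
      oscPlane (some t) ⊓ oscPlane (some (t ^ Nat.card F))}

/-- The number of members of `S` contained in `W`. -/
def numBelow {F : Type*} [Field F] (S : Set (Subsp F)) (W : Subsp F) : ℕ := {U ∈ S | U ≤ W}.ncard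

/-- The number of members of `S` containing `W`. -/
def numAbove {F : Type*} [Field F] (S : Set (Subsp F)) (W : Subsp F) : ℕ := {U ∈ S | W ≤ U}.ncard

/-- `W` lies in some plane of `Γ`. -/
def InΓPlane {F : Type*} [Field F] (W : Subsp F) : Prop := ∃ p ∈ developable F, W ≤ p

/-- `M_𝔭`: the set of points of type `𝔭`. -/
def pointsOfType (F : Type*) [Field F] : PointType → Set (Subsp F)
  | .C => cubic F
  | .zeroΓ => {P | Module.finrank F P = 1 ∧ P ∉ cubic F ∧ numAbove (developable F) P = 0}
  | .oneΓ => {P | Module.finrank F P = 1 ∧ P ∉ cubic F ∧ numAbove (developable F) P = 1}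
  | .threeΓ => {P | Module.finrank F P = 1 ∧ P ∉ cubic F ∧ numAbove (developable F) P = 3}
  | .T => {P | Module.finrank F P = 1 ∧ P ∉ cubic F ∧ ∃ ℓ ∈ tangents F, P ≤ ℓ}
  | .RC => {P | Module.finrank F P = 1 ∧ P ∉ cubic F ∧ ∃ ℓ ∈ realChords F, P ≤ ℓ}
  | .IC => {P | Module.finrank F P = 1 ∧ ∃ ℓ ∈ imaginaryChords F, P ≤ ℓ}

/-- `N_π`: the set of planes of type `π`. -/
def planesOfType (F : Type*) [Field F] : PlaneType → Set (Subsp F)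
  | .Γ => developable F
  | .twoC => {p | Module.finrank F p = 3 ∧ numBelow (cubic F) p = 2}
  | .threeC => {p | Module.finrank F p = 3 ∧ numBelow (cubic F) p = 3}
  | .oneC => {p | Module.finrank F p = 3 ∧ p ∉ developable F ∧ numBelow (cubic F) p = 1}
  | .zeroC => {p | Module.finrank F p = 3 ∧ numBelow (cubic F) p = 0}

/-- `O_λ`: the set (class) of lines of type `λ`. A line is a unisecant (external) if it contains
exactly one (no) point of `𝒞`. The nine classes are disjoint: `EΓ` and `EnΓ` exclude chords and
axes. -/
def linesOfType (F : Type*) [Field F] : LineType → Set (Subsp F)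
  | .RC => realChords F
  | .RA => realAxes F
  | .T => tangents F
  | .IC => imaginaryChords F
  | .IA => imaginaryAxes F
  | .UΓ => {ℓ | Module.finrank F ℓ = 2 ∧ numBelow (cubic F) ℓ = 1 ∧ ℓ ∉ tangents F ∧ InΓPlane ℓ}
  | .UnΓ => {ℓ | Module.finrank F ℓ = 2 ∧ numBelow (cubic F) ℓ = 1 ∧ ¬ InΓPlane ℓ}
  | .EΓ => {ℓ | Module.finrank F ℓ = 2 ∧ numBelow (cubic F) ℓ = 0 ∧
      ℓ ∉ imaginaryChords F ∧ ℓ ∉ realAxes F ∧ ℓ ∉ imaginaryAxes F ∧ InΓPlane ℓ}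
  | .EnΓ => {ℓ | Module.finrank F ℓ = 2 ∧ numBelow (cubic F) ℓ = 0 ∧
      ℓ ∉ imaginaryChords F ∧ ℓ ∉ realAxes F ∧ ℓ ∉ imaginaryAxes F ∧ ¬ InΓPlane ℓ}

/-- The correspondence `λ̃ ↦ λ(λ̃)` of line types. -/
def dualLineType : LineType → LineType
  | .RC => .RA
  | .RA => .RC
  | .T => .T
  | .IC => .IA
  | .IA => .IC
  | .UΓ => .UΓ
  | .UnΓ => .EΓ
  | .EΓ => .UnΓ
  | .EnΓ => .EnΓ

/-- The average, over the lines `ℓ ∈ O`, of the number of points `P ∈ M` on `ℓ`. -/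
def avgPointsOn {F : Type*} [Field F] (M O : Set (Subsp F)) : ℚ :=
  (∑ᶠ ℓ ∈ O, (numBelow M ℓ : ℚ)) / O.ncard

/-- The average, over the lines `ℓ ∈ O`, of the number of planes `p ∈ N` through `ℓ`. -/
def avgPlanesThrough {F : Type*} [Field F] (N O : Set (Subsp F)) : ℚ :=
  (∑ᶠ ℓ ∈ O, (numAbove N ℓ : ℚ)) / O.ncard

end

end TwistedCubic

open TwistedCubic

/-!
# The null polarity of the twisted cubic and the incidence numbers of lines

The null polarity `𝔄` sends a subspace to its orthogonal complement for the alternating form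
`nullForm`, which is nondegenerate in characteristic other than `3`. Hence `𝔄` is an involution that
reverses inclusions, and it sends `P(t)` to the osculating plane at `P(t)`
(`nullPolarity_cubicPoint`). So the number of points of the cubic in `W` is the number of osculating
planes through the polar of `W`, and every incidence number between points and lines is an incidence
number between the polar planes and the polar lines. What has to be shown is that `𝔄` commutes with
`G_q`, that the point types concerned are single orbits, and that the line classes are permuted by
`𝔄`.

*The group.* `GL₂` acts on `K⁴` through its third symmetric power (`symCube`), preserves the cubic,
and multiplies `nullForm` by a scalar. Conversely `G_q` contains nothing else
(`exists_eq_symCubeIso`): after composition with an element of `GL₂`, a projectivity in `G_q` fixes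
`P(∞)`, `P(0)`, `P(1)`. The determinant of four points of the cubic is a Vandermonde product, and a
comparison of such determinants, with two auxiliary points, shows that the parameters' cross-ratios
are preserved; so all points of the cubic are fixed and the map is scalar. There are enough
points for this as soon as `q ≥ 5`. It follows that `𝔄` commutes with `G_q` (`map_nullPolarity`).

*Point orbits.* The osculating planes through the point `x` are the zeros on the projective line of
a binary cubic form (`pointPoly`), and `G_q` is triply transitive on the parameters. Forms with two
or three distinct zeros can thus be moved to a normal form; forms with exactly two zeros are those
of the points on tangents and off the cubic. A form whose only zero is simple is an irreducible
quadratic form once this zero is moved to `∞`, and a form without zeros is an irreducible cubic. Any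
two elements of the closure that are quadratic (cubic) over the finite field are related by an
affine (fractional linear) map over it, since any three (four) elements of the extension field are
linearly dependent, and this makes the corresponding points equivalent. Such forms exist because
`t² - t` and `t³ - t` are not injective on the field, hence not surjective.

*Lines.* Imaginary chords are handled in the algebraic closure, where the polarity and `GL₂` act by
the same formulas. A line through a point of the cubic and in an osculating plane is in the polar
plane of this point, hence totally isotropic and self-polar (`nullPolarity_eq_self`): this covers
the tangents and the class `UΓ`. For the external classes, no three points of the cubic
are collinear (`not_cubicPoint_le_sup`), so that a line with exactly one point of the cubic is not
an imaginary chord; dually, a line in exactly one osculating plane is not an axis of either kind.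
-/

namespace TwistedCubic

open Module

/-! ### The null polarity as an orthogonal complement -/

section Polarity

variable {K : Type*} [Field K]

/-- The alternating bilinear form of the null polarity: `nullPolarity W` is the orthogonal
complement of `W` with respect to it. -/
def nullForm (K : Type*) [Field K] : LinearMap.BilinForm K (Fin 4 → K) :=
  LinearMap.mk₂ K (fun x y => x 3 * y 0 - 3 * x 2 * y 1 + 3 * x 1 * y 2 - x 0 * y 3)
    (fun x x' y => by simp only [Pi.add_apply]; ring)
    (fun a x y => by simp only [Pi.smul_apply, smul_eq_mul]; ring)
    (fun x y y' => by simp only [Pi.add_apply]; ring)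
    (fun a x y => by simp only [Pi.smul_apply, smul_eq_mul]; ring)

theorem nullForm_apply (x y : Fin 4 → K) :
    nullForm K x y = x 3 * y 0 - 3 * x 2 * y 1 + 3 * x 1 * y 2 - x 0 * y 3 := rfl

theorem nullForm_self (x : Fin 4 → K) : nullForm K x x = 0 := by
  rw [nullForm_apply]; ring

theorem nullForm_swap (x y : Fin 4 → K) : nullForm K x y = -nullForm K y x := by
  rw [nullForm_apply, nullForm_apply]; ring

theorem nullForm_isRefl : (nullForm K).IsRefl := fun x y h => by
  rw [nullForm_swap, h, neg_zero]

theorem nullForm_nondegenerate (h3 : (3 : K) ≠ 0) : (nullForm K).Nondegenerate := by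
  have left : ∀ x, (∀ y, nullForm K x y = 0) → x = 0 := by
    intro x hx
    have h0 := hx ![1, 0, 0, 0]
    have h1 := hx ![0, 1, 0, 0]
    have h2 := hx ![0, 0, 1, 0]
    have h3' := hx ![0, 0, 0, 1]
    simp [nullForm_apply, h3] at h0 h1 h2 h3'
    ext i; fin_cases i <;> simp [h0, h1, h2, h3']
  exact ⟨left, fun y hy => left y fun x => by rw [nullForm_swap, hy, neg_zero]⟩

theorem mem_nullPolarity {W : Subsp K} {y : Fin 4 → K} :
    y ∈ nullPolarity W ↔ ∀ x ∈ W, nullForm K x y = 0 := by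
  simp only [nullPolarity, Submodule.mem_iInf]
  refine forall₂_congr fun x _ => ?_
  change x 3 * y 0 + -3 * x 2 * y 1 + 3 * x 1 * y 2 + -x 0 * y 3 = 0 ↔ _
  rw [nullForm_apply]
  ring_nf

theorem nullPolarity_eq_orthogonal (W : Subsp K) :
    nullPolarity W = (nullForm K).orthogonal W := by
  ext y; rw [mem_nullPolarity]; rfl

theorem finrank_nullPolarity (h3 : (3 : K) ≠ 0) (W : Subsp K) :
    finrank K (nullPolarity W) = 4 - finrank K W := by
  rw [nullPolarity_eq_orthogonal,
    LinearMap.BilinForm.finrank_orthogonal (nullForm_nondegenerate h3)]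
  simp

theorem finrank_le_four (W : Subsp K) : finrank K W ≤ 4 := by
  simpa using Submodule.finrank_le W

theorem nullPolarity_nullPolarity (h3 : (3 : K) ≠ 0) (W : Subsp K) :
    nullPolarity (nullPolarity W) = W := by
  rw [nullPolarity_eq_orthogonal, nullPolarity_eq_orthogonal,
    LinearMap.BilinForm.orthogonal_orthogonal (nullForm_nondegenerate h3) nullForm_isRefl]

theorem nullPolarity_injective (h3 : (3 : K) ≠ 0) :
    Function.Injective (nullPolarity : Subsp K → Subsp K) :=
  Function.LeftInverse.injective (nullPolarity_nullPolarity h3)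

theorem nullPolarity_antitone {W U : Subsp K} (h : W ≤ U) : nullPolarity U ≤ nullPolarity W :=
  fun y hy => by
    rw [mem_nullPolarity] at *
    exact fun x hx => hy x (h hx)

theorem nullPolarity_le_nullPolarity (h3 : (3 : K) ≠ 0) {W U : Subsp K} :
    nullPolarity U ≤ nullPolarity W ↔ W ≤ U :=
  ⟨fun h => by
    simpa only [nullPolarity_nullPolarity h3] using nullPolarity_antitone h,
    nullPolarity_antitone⟩

theorem le_nullPolarity_comm {W U : Subsp K} : W ≤ nullPolarity U ↔ U ≤ nullPolarity W := by
  simp only [SetLike.le_def, mem_nullPolarity]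
  exact ⟨fun h x hx y hy => by rw [nullForm_swap, h hy x hx, neg_zero],
    fun h x hx y hy => by rw [nullForm_swap, h hy x hx, neg_zero]⟩

theorem nullPolarity_sup (W U : Subsp K) :
    nullPolarity (W ⊔ U) = nullPolarity W ⊓ nullPolarity U := by
  refine le_antisymm (le_inf (nullPolarity_antitone le_sup_left)
    (nullPolarity_antitone le_sup_right)) ?_
  rw [le_nullPolarity_comm]
  exact sup_le (le_nullPolarity_comm.1 inf_le_left) (le_nullPolarity_comm.1 inf_le_right)

theorem nullPolarity_span_singleton (x : Fin 4 → K) {y : Fin 4 → K} :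
    y ∈ nullPolarity (Submodule.span K {x}) ↔ nullForm K x y = 0 := by
  rw [mem_nullPolarity]
  refine ⟨fun h => h x (Submodule.mem_span_singleton_self x), fun h z hz => ?_⟩
  obtain ⟨a, rfl⟩ := Submodule.mem_span_singleton.1 hz
  simp [h]

theorem nullPolarity_cubicPoint (t : Option K) : nullPolarity (cubicPoint t) = oscPlane t := by
  ext y
  rw [cubicPoint, nullPolarity_span_singleton]
  cases t with
  | none =>
    change _ ↔ (0 : K) * y 0 + 0 * y 1 + 0 * y 2 + 1 * y 3 = 0
    simp [nullForm_apply, cubicVec]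
  | some t =>
    change _ ↔ (1 : K) * y 0 + -3 * t * y 1 + 3 * t ^ 2 * y 2 + -t ^ 3 * y 3 = 0
    simp only [nullForm_apply, cubicVec]
    simp only [Matrix.cons_val]
    ring_nf

/-- A line that is incident with both a point and its polar plane is totally isotropic, hence
self-polar. -/
theorem nullPolarity_eq_self (h3 : (3 : K) ≠ 0) {W : Subsp K} (hW : finrank K W = 2)
    {x : Fin 4 → K} (hx0 : x ≠ 0) (hxW : x ∈ W)
    (hle : W ≤ nullPolarity (Submodule.span K {x})) : nullPolarity W = W := by
  -- modulo `x` the line is one-dimensional, and the form is alternating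
  have hiso : ∀ y ∈ W, ∀ z ∈ W, nullForm K y z = 0 := by
    intro y hy z hz
    have hxy := (nullPolarity_span_singleton x).1 (hle hy)
    have hxz := (nullPolarity_span_singleton x).1 (hle hz)
    have hdep : ¬ LinearIndependent K ![(⟨x, hxW⟩ : W), ⟨y, hy⟩, ⟨z, hz⟩] := by
      intro h
      have := h.fintype_card_le_finrank
      simp [hW] at this
    rw [Fintype.not_linearIndependent_iff] at hdep
    obtain ⟨g, hg, i, hi⟩ := hdep
    have hg' : g 0 • x + g 1 • y + g 2 • z = 0 := by
      have := congrArg Subtype.val hg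
      simpa [Fin.sum_univ_three] using this
    have e1 := congrArg (fun w => nullForm K y w) hg'
    have e2 := congrArg (fun w => nullForm K w z) hg'
    simp only [map_add, map_smul, LinearMap.add_apply, LinearMap.smul_apply, smul_eq_mul,
      map_zero, LinearMap.zero_apply, nullForm_self, hxz, nullForm_swap y x, hxy] at e1 e2
    by_cases h2 : g 2 = 0
    · by_cases h1 : g 1 = 0
      · rw [h1, h2] at hg'
        have h0 : g 0 = 0 := by simpa [hx0] using hg'
        exact absurd (by fin_cases i <;> assumption) hi
      · simpa [h1] using e2
    · simpa [h2] using e1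
  symm
  refine Submodule.eq_of_le_of_finrank_eq (fun z hz => ?_) ?_
  · rw [mem_nullPolarity]
    exact fun y hy => hiso y hy z hz
  · rw [finrank_nullPolarity h3, hW]

end Polarity

/-! ### The cubic in homogeneous parameters and the action of `GL₂` -/

section Sym

variable {K : Type*} [Field K]

/-- The point of the cubic with homogeneous parameter `(u : v)`, that is, with `t = u / v`. -/
def cubicHom (u v : K) : Fin 4 → K := ![u ^ 3, u ^ 2 * v, u * v ^ 2, v ^ 3]

/-- The partial derivative of `cubicHom` with respect to the first parameter. -/
def cubicHomU (u v : K) : Fin 4 → K := ![3 * u ^ 2, 2 * u * v, v ^ 2, 0]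

/-- The partial derivative of `cubicHom` with respect to the second parameter. -/
def cubicHomV (u v : K) : Fin 4 → K := ![0, u ^ 2, 2 * u * v, 3 * v ^ 2]

open Classical in
/-- The affine parameter `u / v ∈ K ∪ {∞}` of the homogeneous parameter `(u : v)`. -/
noncomputable def param (u v : K) : Option K := if v = 0 then none else some (u / v)

theorem param_zero (u : K) : param u 0 = none := by simp [param]

theorem param_of_ne {u v : K} (hv : v ≠ 0) : param u v = some (u / v) := by simp [param, hv]

theorem exists_param (t : Option K) : ∃ u v : K, (u ≠ 0 ∨ v ≠ 0) ∧ param u v = t := by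
  cases t with
  | none => exact ⟨1, 0, by simp, param_zero 1⟩
  | some t => exact ⟨t, 1, by simp, by simp [param]⟩

theorem param_eq_param {u v w z : K} (h : u ≠ 0 ∨ v ≠ 0) (h' : w ≠ 0 ∨ z ≠ 0) :
    param u v = param w z ↔ u * z = w * v := by
  by_cases hv : v = 0 <;> by_cases hz : z = 0
  · simp [param, hv, hz]
  · have hu : u ≠ 0 := by tauto
    simp [param, hv, hz, hu]
  · have hw : w ≠ 0 := by tauto
    simp [param, hv, hz, hw]
  · simp [param, hv, hz, div_eq_div_iff]

theorem span_cubicHom {u v : K} (h : u ≠ 0 ∨ v ≠ 0) :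
    Submodule.span K {cubicHom u v} = cubicPoint (param u v) := by
  by_cases hv : v = 0
  · have hu : u ≠ 0 := by tauto
    subst hv
    rw [param_zero, cubicPoint, ← Submodule.span_singleton_smul_eq (IsUnit.mk0 (u ^ 3) (by simpa))
        (cubicVec none)]
    congr 2
    ext i; fin_cases i <;> simp [cubicHom, cubicVec]
  · rw [param_of_ne hv, cubicPoint,
      ← Submodule.span_singleton_smul_eq (IsUnit.mk0 (v ^ 3) (by simpa))
        (cubicVec (some (u / v)))]
    congr 2
    ext i; fin_cases i <;> simp [cubicHom, cubicVec] <;> field_simp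

/-- By Euler's relation, `3 P = u ∂P/∂u + v ∂P/∂v`; so in characteristic other than `3` the span of
the two partial derivatives contains the point of contact, and is the tangent. -/
theorem span_cubicHom_partials (h3 : (3 : K) ≠ 0) {u v : K} (h : u ≠ 0 ∨ v ≠ 0) :
    Submodule.span K {cubicHomU u v, cubicHomV u v} = tangentLine (param u v) := by
  by_cases hv : v = 0
  · have hu : u ≠ 0 := by tauto
    subst hv
    rw [param_zero, tangentLine, Submodule.span_insert, Submodule.span_insert,
      ← Submodule.span_singleton_smul_eq (IsUnit.mk0 (3 * u ^ 2) (by simp [h3, hu]))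
        ![(1 : K), 0, 0, 0],
      ← Submodule.span_singleton_smul_eq (IsUnit.mk0 (u ^ 2) (by simp [hu]))
        ![(0 : K), 1, 0, 0]]
    congr 3
    · ext i; fin_cases i <;> simp [cubicHomU]
    · ext i; fin_cases i <;> simp [cubicHomV]
  · rw [param_of_ne hv]
    apply le_antisymm
    · rw [Submodule.span_le, Set.pair_subset_iff]
      refine ⟨Submodule.mem_span_pair.2 ⟨0, v ^ 2, ?_⟩,
        Submodule.mem_span_pair.2 ⟨3 * v ^ 2, - (u * v), ?_⟩⟩
      · ext i; fin_cases i <;> simp [cubicHomU] <;> field_simp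
      · ext i; fin_cases i <;> simp [cubicHomV] <;> field_simp <;> ring
    · rw [tangentLine, Submodule.span_le, Set.pair_subset_iff]
      refine ⟨Submodule.mem_span_pair.2 ⟨u / (3 * v ^ 3), 1 / (3 * v ^ 2), ?_⟩,
        Submodule.mem_span_pair.2 ⟨1 / v ^ 2, 0, ?_⟩⟩
      · ext i; fin_cases i <;> simp [cubicHomU, cubicHomV] <;> field_simp <;> ring
      · ext i; fin_cases i <;> simp [cubicHomU, cubicHomV] <;> field_simp

/-- The action on `K⁴` of the matrix `(a b; c d)` of `GL₂`, through the third symmetric power: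
it sends `P(t)` to a multiple of `P((at + b) / (ct + d))`. -/
def symCube (a b c d : K) : (Fin 4 → K) →ₗ[K] (Fin 4 → K) where
  toFun x := ![
    a ^ 3 * x 0 + 3 * a ^ 2 * b * x 1 + 3 * a * b ^ 2 * x 2 + b ^ 3 * x 3,
    a ^ 2 * c * x 0 + (a ^ 2 * d + 2 * a * b * c) * x 1 + (2 * a * b * d + b ^ 2 * c) * x 2
      + b ^ 2 * d * x 3,
    a * c ^ 2 * x 0 + (2 * a * c * d + b * c ^ 2) * x 1 + (a * d ^ 2 + 2 * b * c * d) * x 2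
      + b * d ^ 2 * x 3,
    c ^ 3 * x 0 + 3 * c ^ 2 * d * x 1 + 3 * c * d ^ 2 * x 2 + d ^ 3 * x 3]
  map_add' x y := by ext i; fin_cases i <;> simp <;> ring
  map_smul' r x := by ext i; fin_cases i <;> simp <;> ring

theorem symCube_apply (a b c d : K) (x : Fin 4 → K) : symCube a b c d x = ![
    a ^ 3 * x 0 + 3 * a ^ 2 * b * x 1 + 3 * a * b ^ 2 * x 2 + b ^ 3 * x 3,
    a ^ 2 * c * x 0 + (a ^ 2 * d + 2 * a * b * c) * x 1 + (2 * a * b * d + b ^ 2 * c) * x 2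
      + b ^ 2 * d * x 3,
    a * c ^ 2 * x 0 + (2 * a * c * d + b * c ^ 2) * x 1 + (a * d ^ 2 + 2 * b * c * d) * x 2
      + b * d ^ 2 * x 3,
    c ^ 3 * x 0 + 3 * c ^ 2 * d * x 1 + 3 * c * d ^ 2 * x 2 + d ^ 3 * x 3] := rfl

theorem symCube_adjugate (a b c d : K) (x : Fin 4 → K) :
    symCube d (-b) (-c) a (symCube a b c d x) = (a * d - b * c) ^ 3 • x := by
  ext i; fin_cases i <;> simp [symCube_apply] <;> ring

theorem symCube_cubicHom (a b c d u v : K) :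
    symCube a b c d (cubicHom u v) = cubicHom (a * u + b * v) (c * u + d * v) := by
  ext i; fin_cases i <;> simp [symCube_apply, cubicHom] <;> ring

theorem symCube_cubicHomU (a b c d u v : K) :
    symCube a b c d (cubicHomU u v) =
      a • cubicHomU (a * u + b * v) (c * u + d * v) +
        c • cubicHomV (a * u + b * v) (c * u + d * v) := by
  ext i; fin_cases i <;> simp [symCube_apply, cubicHomU, cubicHomV] <;> ring

theorem symCube_cubicHomV (a b c d u v : K) :
    symCube a b c d (cubicHomV u v) =
      b • cubicHomU (a * u + b * v) (c * u + d * v) +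
        d • cubicHomV (a * u + b * v) (c * u + d * v) := by
  ext i; fin_cases i <;> simp [symCube_apply, cubicHomU, cubicHomV] <;> ring

theorem nullForm_symCube (a b c d : K) (x y : Fin 4 → K) :
    nullForm K (symCube a b c d x) (symCube a b c d y) =
      (a * d - b * c) ^ 3 * nullForm K x y := by
  simp only [nullForm_apply, symCube_apply, Matrix.cons_val]
  ring

theorem nullForm_cubicHom (u v w z : K) :
    nullForm K (cubicHom u v) (cubicHom w z) = (v * w - u * z) ^ 3 := by
  simp only [nullForm_apply, cubicHom, Matrix.cons_val]
  ring

/-- `symCube` as a linear automorphism, for a matrix of nonzero determinant. -/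
noncomputable def symCubeEquiv (a b c d : K) (h : a * d - b * c ≠ 0) :
    (Fin 4 → K) ≃ₗ[K] (Fin 4 → K) :=
  LinearEquiv.ofLinearMap (symCube a b c d)
    (((a * d - b * c) ^ 3)⁻¹ • symCube d (-b) (-c) a)
    (by
      ext1 i; ext1
      have := symCube_adjugate d (-b) (-c) a (Pi.single i 1)
      simp only [neg_neg] at this
      simp only [LinearMap.comp_apply, LinearMap.smul_apply, map_smul, LinearMap.coe_single,
        this, LinearMap.id_apply]
      rw [show d * a - -b * -c = a * d - b * c by ring, inv_smul_smul₀ (pow_ne_zero 3 h)])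
    (by
      ext1 i; ext1
      simp only [LinearMap.comp_apply, LinearMap.smul_apply, LinearMap.coe_single,
        symCube_adjugate, LinearMap.id_apply]
      rw [inv_smul_smul₀ (pow_ne_zero 3 h)])

theorem symCubeEquiv_apply (a b c d : K) (h : a * d - b * c ≠ 0) (x : Fin 4 → K) :
    symCubeEquiv a b c d h x = symCube a b c d x := rfl

/-- A matrix of nonzero determinant sends nonzero parameters to nonzero parameters. -/
theorem mobius_ne_zero {a b c d u v : K} (h : a * d - b * c ≠ 0) (huv : u ≠ 0 ∨ v ≠ 0) :
    a * u + b * v ≠ 0 ∨ c * u + d * v ≠ 0 := by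
  by_contra! hc
  have e1 : (a * d - b * c) * u = 0 := by linear_combination d * hc.1 - b * hc.2
  have e2 : (a * d - b * c) * v = 0 := by linear_combination a * hc.2 - c * hc.1
  simp [h] at e1 e2
  tauto

end Sym

section Incidence

variable {K : Type*} [Field K]

theorem cubicPoint_le_oscPlane (s t : Option K) : cubicPoint s ≤ oscPlane t ↔ s = t := by
  obtain ⟨u, v, huv, rfl⟩ := exists_param s
  obtain ⟨w, z, hwz, rfl⟩ := exists_param t
  rw [← nullPolarity_cubicPoint, ← span_cubicHom huv, ← span_cubicHom hwz,
    Submodule.span_singleton_le_iff_mem, nullPolarity_span_singleton, nullForm_cubicHom,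
    pow_eq_zero_iff three_ne_zero, sub_eq_zero, param_eq_param huv hwz, mul_comm z, eq_comm]

theorem cubicPoint_injective : Function.Injective (cubicPoint : Option K → Subsp K) :=
  fun s t h => ((cubicPoint_le_oscPlane t s).1 (h ▸ (cubicPoint_le_oscPlane s s).2 rfl)).symm

theorem oscPlane_injective : Function.Injective (oscPlane : Option K → Subsp K) :=
  fun s t h => (cubicPoint_le_oscPlane s t).1 (h ▸ (cubicPoint_le_oscPlane s s).2 rfl)

theorem cubicVec_ne_zero (t : Option K) : cubicVec t ≠ 0 := by
  cases t with
  | none => exact fun h => by simpa [cubicVec] using congrFun h 0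
  | some t => exact fun h => by simpa [cubicVec] using congrFun h 3

theorem finrank_cubicPoint (t : Option K) : finrank K (cubicPoint t) = 1 :=
  finrank_span_singleton (cubicVec_ne_zero t)

end Incidence

/-! ### The group of the cubic is `PGL₂` -/

section Group

variable {F : Type*} [Field F]

/-- The projectivity induced by `symCube`. -/
noncomputable def symCubeIso (a b c d : F) (h : a * d - b * c ≠ 0) : Subsp F ≃o Subsp F :=
  Submodule.orderIsoMapComap (symCubeEquiv a b c d h)

theorem symCubeIso_apply (a b c d : F) (h : a * d - b * c ≠ 0) (W : Subsp F) :
    symCubeIso a b c d h W = W.map (symCube a b c d) := rfl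

theorem symCubeIso_cubicPoint {a b c d : F} (h : a * d - b * c ≠ 0) {u v : F}
    (huv : u ≠ 0 ∨ v ≠ 0) :
    symCubeIso a b c d h (cubicPoint (param u v)) =
      cubicPoint (param (a * u + b * v) (c * u + d * v)) := by
  rw [← span_cubicHom huv, ← span_cubicHom (mobius_ne_zero h huv), symCubeIso_apply,
    Submodule.map_span, Set.image_singleton, symCube_cubicHom]

theorem symCubeIso_cubicPoint_none {a b c d : F} (h : a * d - b * c ≠ 0) :
    symCubeIso a b c d h (cubicPoint none) = cubicPoint (param a c) := by
  have := symCubeIso_cubicPoint h (u := 1) (v := 0) (by simp)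
  simpa only [param_zero, mul_one, mul_zero, add_zero] using this

theorem symCubeIso_cubicPoint_zero {a b c d : F} (h : a * d - b * c ≠ 0) :
    symCubeIso a b c d h (cubicPoint (some 0)) = cubicPoint (param b d) := by
  have := symCubeIso_cubicPoint h (u := 0) (v := 1) (by simp)
  simpa only [param_of_ne one_ne_zero, mul_one, mul_zero, zero_add, zero_div] using this

theorem symCubeIso_cubicPoint_one {a b c d : F} (h : a * d - b * c ≠ 0) :
    symCubeIso a b c d h (cubicPoint (some 1)) = cubicPoint (param (a + b) (c + d)) := by
  have := symCubeIso_cubicPoint h (u := 1) (v := 1) (by simp)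
  simpa only [param_of_ne one_ne_zero, mul_one, div_one] using this

theorem symCubeIso_mem (a b c d : F) (h : a * d - b * c ≠ 0) :
    symCubeIso a b c d h ∈ cubicGroup F := by
  refine ⟨⟨symCubeEquiv a b c d h, fun W => rfl⟩, Set.Subset.antisymm ?_ ?_⟩
  · rintro _ ⟨_, ⟨t, rfl⟩, rfl⟩
    obtain ⟨u, v, huv, rfl⟩ := exists_param t
    exact ⟨_, (symCubeIso_cubicPoint h huv).symm⟩
  · rintro _ ⟨t, rfl⟩
    obtain ⟨w, z, hwz, rfl⟩ := exists_param t
    have h' : d * a - -b * -c ≠ 0 := by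
      rwa [show d * a - -b * -c = a * d - b * c by ring]
    -- the preimage is given by the adjugate matrix
    refine ⟨_, ⟨param (d * w + -b * z) (-c * w + a * z), rfl⟩, ?_⟩
    rw [symCubeIso_cubicPoint h (mobius_ne_zero h' hwz)]
    congr 1
    rw [param_eq_param (mobius_ne_zero h (mobius_ne_zero h' hwz)) hwz]
    ring

/-- `GL₂` moves the parameters `∞`, `0`, `1` to any three distinct parameters. -/
theorem exists_matrix_param {r s t : Option F} (hrs : r ≠ s) (hrt : r ≠ t) (hst : s ≠ t) :
    ∃ a b c d : F, a * d - b * c ≠ 0 ∧ param a c = r ∧ param b d = s ∧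
      param (a + b) (c + d) = t := by
  obtain ⟨u₁, v₁, h₁, rfl⟩ := exists_param r
  obtain ⟨u₂, v₂, h₂, rfl⟩ := exists_param s
  obtain ⟨u₃, v₃, h₃, rfl⟩ := exists_param t
  rw [Ne, param_eq_param h₁ h₂, ← sub_eq_zero] at hrs
  rw [Ne, param_eq_param h₁ h₃, ← sub_eq_zero] at hrt
  rw [Ne, param_eq_param h₂ h₃, ← sub_eq_zero] at hst
  -- Cramer's rule: write the third vector as a combination of the first two
  set α := -(u₂ * v₃ - u₃ * v₂) with hα
  set β := u₁ * v₃ - u₃ * v₁ with hβ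
  have hα0 : α ≠ 0 := neg_ne_zero.2 hst
  have e1 : α * u₁ + β * u₂ = (u₁ * v₂ - u₂ * v₁) * u₃ := by rw [hα, hβ]; ring
  have e2 : α * v₁ + β * v₂ = (u₁ * v₂ - u₂ * v₁) * v₃ := by rw [hα, hβ]; ring
  have key : ∀ {k u v : F}, k ≠ 0 → (u ≠ 0 ∨ v ≠ 0) → param (k * u) (k * v) = param u v := by
    intro k u v hk huv
    rw [param_eq_param (by simpa [hk] using huv) huv]
    ring
  refine ⟨α * u₁, β * u₂, α * v₁, β * v₂, ?_, key hα0 h₁, key hrt h₂, ?_⟩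
  · rw [show α * u₁ * (β * v₂) - β * u₂ * (α * v₁) = α * β * (u₁ * v₂ - u₂ * v₁) by ring]
    exact mul_ne_zero (mul_ne_zero hα0 hrt) hrs
  · rw [e1, e2, key hrs h₃]

/-- `G_q` is triply transitive on the cubic. -/
theorem exists_mem_cubicGroup {r s t : Option F} (hrs : r ≠ s) (hrt : r ≠ t) (hst : s ≠ t) :
    ∃ φ ∈ cubicGroup F, φ (cubicPoint none) = cubicPoint r ∧
      φ (cubicPoint (some 0)) = cubicPoint s ∧ φ (cubicPoint (some 1)) = cubicPoint t := by
  obtain ⟨a, b, c, d, h, rfl, rfl, rfl⟩ := exists_matrix_param hrs hrt hst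
  exact ⟨symCubeIso a b c d h, symCubeIso_mem a b c d h, symCubeIso_cubicPoint_none h,
    symCubeIso_cubicPoint_zero h, symCubeIso_cubicPoint_one h⟩

theorem det_cubicVec_affine (x y z w : F) :
    (Matrix.of ![cubicVec (some x), cubicVec (some y), cubicVec (some z),
      cubicVec (some w)]).det =
      (x - y) * (x - z) * (x - w) * (y - z) * (y - w) * (z - w) := by
  simp [Matrix.det_succ_row_zero, Fin.sum_univ_succ, cubicVec, Fin.succAbove]
  ring

theorem det_cubicVec_infty (x y z : F) :
    (Matrix.of ![cubicVec none, cubicVec (some x), cubicVec (some y),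
      cubicVec (some z)]).det = (x - y) * (x - z) * (y - z) := by
  simp [Matrix.det_succ_row_zero, Fin.sum_univ_succ, cubicVec, Fin.succAbove]
  ring

theorem prod_mul_det_cubicVec (e : (Fin 4 → F) →ₗ[F] (Fin 4 → F)) {c : Option F → F}
    {σ : Option F → Option F} (he : ∀ t, e (cubicVec t) = c t • cubicVec (σ t))
    (p q r s : Option F) :
    c p * c q * c r * c s *
        (Matrix.of ![cubicVec (σ p), cubicVec (σ q), cubicVec (σ r), cubicVec (σ s)]).det =
      LinearMap.det e *
        (Matrix.of ![cubicVec p, cubicVec q, cubicVec r, cubicVec s]).det := by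
  have h := (Pi.basisFun F (Fin 4)).det_comp e ![cubicVec p, cubicVec q, cubicVec r, cubicVec s]
  have h2 : (e ∘ ![cubicVec p, cubicVec q, cubicVec r, cubicVec s] : Fin 4 → Fin 4 → F) =
      fun i => (![c p, c q, c r, c s] i) •
        (![cubicVec (σ p), cubicVec (σ q), cubicVec (σ r), cubicVec (σ s)] i) := by
    funext i; fin_cases i <;> simp [he]
  rw [h2, AlternatingMap.map_smul_univ, Pi.basisFun_det_apply, Pi.basisFun_det_apply] at h
  simpa [Fin.prod_univ_four] using h

theorem exists_notMem_of_card_lt {α : Type*} [Finite α] (s : Finset α)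
    (hs : s.card < Nat.card α) : ∃ x, x ∉ s := by
  by_contra! h
  have := Fintype.ofFinite α
  rw [Nat.card_eq_fintype_card, ← Finset.card_univ, Finset.eq_univ_iff_forall.2 h] at hs
  exact lt_irrefl _ hs

/-- Four points of the cubic span a parallelepiped whose volume is a Vandermonde determinant.
Comparing volumes, a linear map that permutes the points preserves the cross-ratio of any four
parameters `∞, 0, 1, t`, with the help of two further points; here `6 ≤ q + 1` is needed. -/
theorem perm_eq_self_of_fixes [Finite F] (hq : 5 ≤ Nat.card F)
    (e : (Fin 4 → F) →ₗ[F] (Fin 4 → F)) {c : Option F → F} (hc : ∀ t, c t ≠ 0)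
    {σ : Option F → Option F} (hσ : Function.Injective σ)
    (he : ∀ t, e (cubicVec t) = c t • cubicVec (σ t))
    (hinf : σ none = none) (hzero : σ (some 0) = some 0) (hone : σ (some 1) = some 1)
    (t : Option F) : σ t = t := by
  classical
  cases t with
  | none => exact hinf
  | some t =>
    by_cases ht0 : t = 0
    · rw [ht0, hzero]
    by_cases ht1 : t = 1
    · rw [ht1, hone]
    obtain ⟨u, hu⟩ := exists_notMem_of_card_lt ({0, 1, t} : Finset F)
      (Finset.card_le_three.trans_lt (by omega))
    obtain ⟨v, hv⟩ := exists_notMem_of_card_lt ({0, 1, t, u} : Finset F)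
      (Finset.card_le_four.trans_lt (by omega))
    simp only [Finset.mem_insert, Finset.mem_singleton, not_or] at hu hv
    have hfin : ∀ x : F, ∃ y, σ (some x) = some y := fun x =>
      Option.ne_none_iff_exists'.1 fun h => by simpa using hσ (h.trans hinf.symm)
    obtain ⟨t', ht'⟩ := hfin t
    obtain ⟨u', hu'⟩ := hfin u
    obtain ⟨v', hv'⟩ := hfin v
    have inj : ∀ {x y x' y' : F}, σ (some x) = some x' → σ (some y) = some y' → x ≠ y →
        x' - y' ≠ 0 := fun {x y x' y'} h h' hne h0 => hne <| by
      have h1 : some x' = some y' := congrArg some (sub_eq_zero.1 h0)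
      exact Option.some_injective _ (hσ ((h.trans h1).trans h'.symm))
    have e1 := prod_mul_det_cubicVec e he none (some 1) (some u) (some v)
    have e2 := prod_mul_det_cubicVec e he (some 0) (some t) (some u) (some v)
    have e3 := prod_mul_det_cubicVec e he none (some t) (some u) (some v)
    have e4 := prod_mul_det_cubicVec e he (some 0) (some 1) (some u) (some v)
    rw [hinf, hone, hu', hv', det_cubicVec_infty, det_cubicVec_infty] at e1
    rw [hzero, ht', hu', hv', det_cubicVec_affine, det_cubicVec_affine] at e2
    rw [hinf, ht', hu', hv', det_cubicVec_infty, det_cubicVec_infty] at e3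
    rw [hzero, hone, hu', hv', det_cubicVec_affine, det_cubicVec_affine] at e4
    have key : (c none * c (some 1) * c (some u) * c (some v)) *
        (c (some 0) * c (some t) * c (some u) * c (some v)) *
        (((t' - u') * (t' - v') * (u' - v')) *
          ((0 - u') * (0 - v') * (1 - u') * (1 - v') * (u' - v'))) * (t' - t) = 0 := by
      have h12 := congrArg₂ (· * ·) e1 e2
      have h34 := congrArg₂ (· * ·) e3 e4
      linear_combination -h12 + t * h34
    have hne := inj ht' hu' (Ne.symm hu.2.2)
    have hne2 := inj ht' hv' (Ne.symm hv.2.2.1)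
    have hne3 := inj hu' hv' (Ne.symm hv.2.2.2)
    have hne4 := inj hzero hu' (Ne.symm hu.1)
    have hne5 := inj hzero hv' (Ne.symm hv.1)
    have hne6 := inj hone hu' (Ne.symm hu.2.1)
    have hne7 := inj hone hv' (Ne.symm hv.2.1)
    simp only [mul_eq_zero, hc, hne, hne2, hne3, hne4, hne5, hne6, hne7, false_or] at key
    rw [ht', sub_eq_zero.1 key]

/-- A linear map that fixes all points of the cubic is scalar. -/
theorem exists_eq_smul_of_fixes [Finite F] (hq : 5 ≤ Nat.card F)
    (e : (Fin 4 → F) →ₗ[F] (Fin 4 → F)) {c : Option F → F} (hc : ∀ t, c t ≠ 0)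
    (he : ∀ t, e (cubicVec t) = c t • cubicVec t) : ∃ k : F, k ≠ 0 ∧ ∀ x, e x = k • x := by
  classical
  obtain ⟨t, ht⟩ := exists_notMem_of_card_lt ({0, 1} : Finset F)
    (Finset.card_le_two.trans_lt (by omega))
  obtain ⟨u, hu⟩ := exists_notMem_of_card_lt ({0, 1, t} : Finset F)
    (Finset.card_le_three.trans_lt (by omega))
  simp only [Finset.mem_insert, Finset.mem_singleton, not_or] at ht hu
  obtain ⟨ht0, ht1⟩ := ht
  obtain ⟨hu0, hu1, hut⟩ := hu
  have affine : ∀ x y z w : F, x ≠ y → x ≠ z → x ≠ w → y ≠ z → y ≠ w → z ≠ w →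
      c (some x) * c (some y) * c (some z) * c (some w) = LinearMap.det e := by
    intro x y z w h1 h2 h3 h4 h5 h6
    have h := prod_mul_det_cubicVec e (σ := id) he (some x) (some y) (some z) (some w)
    simp only [id] at h
    refine mul_right_cancel₀ ?_ h
    rw [det_cubicVec_affine]
    simp only [ne_eq, mul_eq_zero, sub_eq_zero, h1, h2, h3, h4, h5, h6, or_self,
      not_false_eq_true]
  have infty : ∀ x y z : F, x ≠ y → x ≠ z → y ≠ z →
      c none * c (some x) * c (some y) * c (some z) = LinearMap.det e := by
    intro x y z h1 h2 h3
    have h := prod_mul_det_cubicVec e (σ := id) he none (some x) (some y) (some z)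
    simp only [id] at h
    refine mul_right_cancel₀ ?_ h
    rw [det_cubicVec_infty]
    simp only [ne_eq, mul_eq_zero, sub_eq_zero, h1, h2, h3, or_self, not_false_eq_true]
  have ht0' := Ne.symm ht0
  have ht1' := Ne.symm ht1
  have hu0' := Ne.symm hu0
  have hu1' := Ne.symm hu1
  have hut' := Ne.symm hut
  -- two points have the same eigenvalue, by comparison of two volumes with three common points
  have c1 : c none = c (some 1) := by
    have h := (infty 0 t u ht0' hu0' hut').trans
      (affine 1 0 t u one_ne_zero ht1' hu1' ht0' hu0' hut').symm
    simpa [mul_assoc, hc] using h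
  have c0 : c none = c (some 0) := by
    have h := (infty 1 t u ht1' hu1' hut').trans
      (affine 0 1 t u zero_ne_one ht0' hu0' ht1' hu1' hut').symm
    simpa [mul_assoc, hc] using h
  have ct : c none = c (some t) := by
    have h := (infty 1 0 u one_ne_zero hu1' hu0').trans
      (affine t 1 0 u ht1 ht0 hut' one_ne_zero hu1' hu0').symm
    simpa [mul_assoc, hc] using h
  refine ⟨c none, hc none, fun x => ?_⟩
  have a1 := he none
  have a2 := he (some 0)
  have a3 := he (some 1)
  have a4 := he (some t)
  rw [← c0] at a2
  rw [← c1] at a3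
  rw [← ct] at a4
  set k := c none
  have hk : ∀ y, (e - k • LinearMap.id : (Fin 4 → F) →ₗ[F] (Fin 4 → F)) y = e y - k • y :=
    fun y => rfl
  set f : (Fin 4 → F) →ₗ[F] (Fin 4 → F) := e - k • LinearMap.id
  suffices hf : f x = 0 from sub_eq_zero.1 ((hk x).symm.trans hf)
  have b : ∀ {y}, e y = k • y → f y = 0 := fun {y} h => (hk y).trans (sub_eq_zero.2 h)
  have b1 := b a1
  have b2 := b a2
  have b3 := b a3
  have b4 := b a4
  -- the four points fixed span the space
  have htt : t ^ 2 - t ≠ 0 := by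
    rw [show t ^ 2 - t = t * (t - 1) by ring]
    exact mul_ne_zero ht0 (sub_ne_zero.2 ht1)
  have hx : x = (x 0) • cubicVec none + (x 3) • cubicVec (some 0) +
      ((x 1 - x 2) / (t ^ 2 - t)) • (cubicVec (some t) - t • cubicVec (some 1)
        - (t ^ 3 - t) • cubicVec none - (1 - t) • cubicVec (some 0)) +
      (x 2) • (cubicVec (some 1) - cubicVec none - cubicVec (some 0)) := by
    ext i; fin_cases i <;> simp [cubicVec]
    field_simp
    ring
  rw [hx]
  simp [b1, b2, b3, b4]

theorem exists_map_cubicPoint {φ : Subsp F ≃o Subsp F} (hφ : φ ∈ cubicGroup F) (t : Option F) :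
    ∃ s, φ (cubicPoint t) = cubicPoint s := by
  have : φ (cubicPoint t) ∈ cubic F := by
    rw [← hφ.2]
    exact Set.mem_image_of_mem _ ⟨t, rfl⟩
  obtain ⟨s, hs⟩ := this
  exact ⟨s, hs.symm⟩

/-- `G_q` consists of the projectivities induced by `GL₂`. -/
theorem exists_eq_symCubeIso [Finite F] (hq : 5 ≤ Nat.card F) {φ : Subsp F ≃o Subsp F}
    (hφ : φ ∈ cubicGroup F) :
    ∃ (a b c d : F) (h : a * d - b * c ≠ 0), φ = symCubeIso a b c d h := by
  choose σ hσ using exists_map_cubicPoint hφ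
  have σinj : Function.Injective σ := fun s t h =>
    cubicPoint_injective (φ.injective (by rw [hσ, hσ, h]))
  obtain ⟨a, b, c, d, h, h1, h2, h3⟩ := exists_matrix_param
    (σinj.ne (show (none : Option F) ≠ some 0 by simp))
    (σinj.ne (show (none : Option F) ≠ some 1 by simp))
    (σinj.ne (show (some 0 : Option F) ≠ some 1 by simp))
  refine ⟨a, b, c, d, h, ?_⟩
  -- the quotient of the two projectivities fixes the parameters `∞`, `0`, `1`
  set g := symCubeIso a b c d h with hg
  have hψ : g⁻¹ * φ ∈ cubicGroup F :=
    mul_mem (inv_mem (symCubeIso_mem a b c d h)) hφ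
  set ψ := g⁻¹ * φ with hψdef
  have fix : ∀ s, g (cubicPoint s) = cubicPoint (σ s) → ψ (cubicPoint s) = cubicPoint s := by
    intro s hs
    rw [hψdef, RelIso.mul_apply, hσ, ← hs, RelIso.inv_apply_self]
  have f1 := fix none (h1 ▸ symCubeIso_cubicPoint_none h)
  have f2 := fix (some 0) (h2 ▸ symCubeIso_cubicPoint_zero h)
  have f3 := fix (some 1) (h3 ▸ symCubeIso_cubicPoint_one h)
  choose τ hτ using exists_map_cubicPoint hψ
  have τinj : Function.Injective τ := fun s t h =>
    cubicPoint_injective (ψ.injective (by rw [hτ, hτ, h]))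
  obtain ⟨e, he⟩ := hψ.1
  have hex : ∀ t, ∃ k : F, e (cubicVec t) = k • cubicVec (τ t) := by
    intro t
    have h : e (cubicVec t) ∈ cubicPoint (τ t) := by
      rw [← hτ, he]
      exact Submodule.mem_map_of_mem (Submodule.mem_span_singleton_self _)
    obtain ⟨k, hk⟩ := Submodule.mem_span_singleton.1 h
    exact ⟨k, hk.symm⟩
  choose k hk using hex
  have hk0 : ∀ t, k t ≠ 0 := by
    intro t h0
    have := hk t
    rw [h0, zero_smul, LinearEquiv.map_eq_zero_iff] at this
    exact cubicVec_ne_zero t this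
  have hid := perm_eq_self_of_fixes hq e.toLinearMap hk0 τinj hk
    (cubicPoint_injective ((hτ _).symm.trans f1)) (cubicPoint_injective ((hτ _).symm.trans f2))
    (cubicPoint_injective ((hτ _).symm.trans f3))
  obtain ⟨m, hm0, hm⟩ := exists_eq_smul_of_fixes hq e.toLinearMap hk0
    (fun t => (hk t).trans (by rw [hid]))
  have hψ1 : ψ = 1 := by
    apply DFunLike.ext
    intro W
    rw [he, RelIso.coe_one, id, show e.toLinearMap = m • LinearMap.id from LinearMap.ext hm,
      Submodule.map_smul _ _ _ hm0, Submodule.map_id]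
  exact (inv_mul_eq_one.1 hψ1).symm

/-- The null polarity commutes with `G_q`, since `GL₂` acts by similitudes of `nullForm`. -/
theorem map_nullPolarity [Finite F] (hq : 5 ≤ Nat.card F) {φ : Subsp F ≃o Subsp F}
    (hφ : φ ∈ cubicGroup F) (W : Subsp F) : φ (nullPolarity W) = nullPolarity (φ W) := by
  obtain ⟨a, b, c, d, h, rfl⟩ := exists_eq_symCubeIso hq hφ
  ext y
  obtain ⟨y, rfl⟩ := (symCubeEquiv a b c d h).surjective y
  rw [mem_nullPolarity]
  have hmem : ∀ (U : Subsp F) (z : Fin 4 → F),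
      symCubeEquiv a b c d h z ∈ symCubeIso a b c d h U ↔ z ∈ U := fun U z =>
    (symCubeEquiv a b c d h).injective.mem_set_image (s := (U : Set (Fin 4 → F)))
  rw [hmem, mem_nullPolarity]
  have hform : ∀ x, nullForm F (symCubeEquiv a b c d h x) (symCubeEquiv a b c d h y) = 0 ↔
      nullForm F x y = 0 := fun x => by
    rw [symCubeEquiv_apply, symCubeEquiv_apply, nullForm_symCube, mul_eq_zero,
      or_iff_right (pow_ne_zero 3 h)]
  refine ⟨fun H x hx => ?_, fun H x hx => ?_⟩
  · obtain ⟨x, rfl⟩ := (symCubeEquiv a b c d h).surjective x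
    exact (hform x).2 (H x ((hmem W x).1 hx))
  · exact (hform x).1 (H _ ((hmem W x).2 hx))

end Group

/-! ### Binary quadratic and cubic forms without zeros over a finite field -/

section FiniteField

variable {F : Type*} [Field F] [Finite F]

theorem exists_forall_sq_sub_ne : ∃ c : F, ∀ t : F, t ^ 2 - t ≠ c := by
  have h : ¬ Function.Surjective fun t : F => t ^ 2 - t := fun h => by
    have := Finite.injective_iff_surjective.2 h (show (0 : F) ^ 2 - 0 = 1 ^ 2 - 1 by ring)
    exact zero_ne_one this
  simpa [Function.Surjective] using h

theorem exists_forall_cube_sub_ne : ∃ c : F, ∀ t : F, t ^ 3 - t ≠ c := by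
  have h : ¬ Function.Surjective fun t : F => t ^ 3 - t := fun h => by
    have := Finite.injective_iff_surjective.2 h (show (0 : F) ^ 3 - 0 = 1 ^ 3 - 1 by ring)
    exact zero_ne_one this
  simpa [Function.Surjective] using h

variable {L : Type*} [Field L] [Algebra F L]

theorem pow_card_pow_natDegree_minpoly {θ : L} (hθ : IsIntegral F θ) :
    θ ^ (Nat.card F ^ (minpoly F θ).natDegree) = θ := by
  have : FiniteDimensional F (IntermediateField.adjoin F {θ}) :=
    IntermediateField.adjoin.finiteDimensional hθ
  have : Finite (IntermediateField.adjoin F {θ}) := Module.finite_of_finite F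
  have := Fintype.ofFinite (IntermediateField.adjoin F {θ})
  have hcard := Module.natCard_eq_pow_finrank (K := F) (V := IntermediateField.adjoin F {θ})
  rw [IntermediateField.adjoin.finrank hθ] at hcard
  have h := FiniteField.pow_card (IntermediateField.AdjoinSimple.gen F θ)
  rw [← Nat.card_eq_fintype_card, hcard] at h
  simpa using congrArg Subtype.val h

omit [Finite F] in
theorem natDegree_minpoly_of_no_root {p : Polynomial F} (hdeg : p.natDegree ∈ Finset.Icc 2 3)
    (hroot : ∀ t, ¬ p.IsRoot t) {θ : L} (hθ : Polynomial.aeval θ p = 0) :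
    (minpoly F θ).natDegree = p.natDegree := by
  have hp : Irreducible p :=
    Polynomial.irreducible_of_degree_le_three_of_not_isRoot (by
      rw [Finset.mem_Icc] at hdeg ⊢; omega) hroot
  rw [← minpoly.eq_of_irreducible hp hθ, Polynomial.natDegree_mul_C]
  simpa using hp.ne_zero

theorem add_pow_card (x y : L) (n : ℕ) :
    (x + y) ^ (Nat.card F ^ n) = x ^ (Nat.card F ^ n) + y ^ (Nat.card F ^ n) := by
  have := Fintype.ofFinite F
  obtain ⟨p, hp⟩ := CharP.exists F
  obtain ⟨k, hprime, hk⟩ := FiniteField.card F p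
  have := Fact.mk hprime
  have : CharP L p := charP_of_injective_algebraMap (algebraMap F L).injective p
  rw [Nat.card_eq_fintype_card, hk, ← pow_mul, add_pow_char_pow]

theorem algebraMap_pow_card (a : F) (n : ℕ) :
    (algebraMap F L a) ^ (Nat.card F ^ n) = algebraMap F L a := by
  have := Fintype.ofFinite F
  rw [Nat.card_eq_fintype_card, ← map_pow, FiniteField.pow_card_pow]

/-- The solutions of `x ^ (q ^ n) = x` form a set of at most `q ^ n` elements, so that more than
`n` of them are linearly dependent over `F`. -/
theorem exists_sum_eq_zero_of_pow_card {n m : ℕ} (hn : n ≠ 0) (hm : n < m) (v : Fin m → L)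
    (hv : ∀ i, v i ^ (Nat.card F ^ n) = v i) :
    ∃ g : Fin m → F, g ≠ 0 ∧ ∑ i, algebraMap F L (g i) * v i = 0 := by
  classical
  have hcard : 1 < Nat.card F := Finite.one_lt_card
  have hqn : 1 < Nat.card F ^ n := Nat.one_lt_pow hn hcard
  have hne := FiniteField.X_pow_card_sub_X_ne_zero L hqn
  set p : Polynomial L := Polynomial.X ^ (Nat.card F ^ n) - Polynomial.X with hp
  have hpcard : p.roots.toFinset.card ≤ Nat.card F ^ n :=
    (Multiset.toFinset_card_le _).trans ((Polynomial.card_roots' p).trans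
      (FiniteField.X_pow_card_sub_X_natDegree_eq L hqn).le)
  have hmem : ∀ g : Fin m → F, ∑ i, algebraMap F L (g i) * v i ∈ p.roots.toFinset := by
    intro g
    rw [Multiset.mem_toFinset, Polynomial.mem_roots hne, hp, Polynomial.IsRoot.def]
    simp only [Polynomial.eval_sub, Polynomial.eval_pow, Polynomial.eval_X, sub_eq_zero]
    have hsum : ∀ s : Finset (Fin m), (∑ i ∈ s, algebraMap F L (g i) * v i) ^ (Nat.card F ^ n) =
        ∑ i ∈ s, algebraMap F L (g i) * v i := by
      intro s
      induction s using Finset.induction_on with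
      | empty => rw [Finset.sum_empty, zero_pow (by omega)]
      | insert i s hi ih =>
        rw [Finset.sum_insert hi, add_pow_card, ih, mul_pow, hv, algebraMap_pow_card]
    exact hsum _
  have := Fintype.ofFinite F
  obtain ⟨g, -, g', -, hgg', heq⟩ := Finset.exists_ne_map_eq_of_card_lt_of_maps_to
    (s := (Finset.univ : Finset (Fin m → F))) (t := p.roots.toFinset)
    (f := fun g => ∑ i, algebraMap F L (g i) * v i)
    (hpcard.trans_lt (by
      rw [Finset.card_univ, Fintype.card_fun, Fintype.card_fin, ← Nat.card_eq_fintype_card]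
      exact Nat.pow_lt_pow_right hcard hm))
    (fun g _ => hmem g)
  refine ⟨g - g', sub_ne_zero.2 hgg', ?_⟩
  rw [← sub_eq_zero, ← Finset.sum_sub_distrib] at heq
  simpa [sub_mul] using heq

/-- `GL₂` is transitive on the elements of the cubic extension outside `F`. -/
theorem exists_mobius_of_pow_card {θ η : L} (hθ : θ ^ (Nat.card F ^ 3) = θ)
    (hη : η ^ (Nat.card F ^ 3) = η) (hθF : ∀ t : F, algebraMap F L t ≠ θ)
    (hηF : ∀ t : F, algebraMap F L t ≠ η) :
    ∃ a b c d : F, a * d - b * c ≠ 0 ∧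
      algebraMap F L a * θ + algebraMap F L b =
        (algebraMap F L c * θ + algebraMap F L d) * η := by
  obtain ⟨g, hg, hsum⟩ := exists_sum_eq_zero_of_pow_card (F := F) (n := 3) (m := 4)
    (by norm_num) (by norm_num) ![θ, 1, θ * η, η]
    (by intro i; fin_cases i <;> simp [mul_pow, hθ, hη])
  simp only [Fin.sum_univ_four, Matrix.cons_val] at hsum
  have lin : ∀ a b : F, algebraMap F L a * θ + algebraMap F L b = 0 → a = 0 ∧ b = 0 := by
    intro a b h
    have ha : a = 0 := by
      by_contra ha
      refine hθF (-b / a) ?_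
      have ha' : algebraMap F L a ≠ 0 := by simpa using ha
      rw [map_div₀, map_neg, div_eq_iff ha']
      linear_combination -h
    exact ⟨ha, by simpa [ha] using h⟩
  refine ⟨g 0, g 1, -g 2, -g 3, fun hdet => ?_, by simp only [map_neg]; linear_combination hsum⟩
  have hdet' := congrArg (algebraMap F L) hdet
  simp only [map_sub, map_mul, map_neg, map_zero] at hdet'
  -- a degenerate matrix would make `η` a quotient of two elements of `F`
  by_cases h2 : g 2 = 0
  · by_cases h3 : g 3 = 0
    · simp only [h2, h3, map_zero, zero_mul, add_zero, mul_one] at hsum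
      obtain ⟨h0, h1⟩ := lin _ _ hsum
      exact hg (by ext i; fin_cases i <;> assumption)
    · have h0 : g 0 = 0 := by simpa [h2, h3] using hdet
      refine hηF (-g 1 / g 3) ?_
      rw [map_div₀, map_neg, div_eq_iff (by simpa using h3)]
      simp only [h2, h0, map_zero, zero_mul, zero_add, add_zero, mul_one] at hsum
      linear_combination -hsum
  · refine hηF (-g 0 / g 2) ?_
    have h2' : algebraMap F L (g 2) ≠ 0 := by simpa using h2
    have hne : algebraMap F L (g 2) * θ + algebraMap F L (g 3) ≠ 0 := fun h => h2 (lin _ _ h).1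
    rw [map_div₀, map_neg, div_eq_iff h2']
    refine mul_left_cancel₀ hne ?_
    linear_combination (-algebraMap F L (g 2)) * hsum + hdet'

/-- The affine group is transitive on the elements of the quadratic extension outside `F`. -/
theorem exists_affine_of_pow_card {θ η : L} (hθ : θ ^ (Nat.card F ^ 2) = θ)
    (hη : η ^ (Nat.card F ^ 2) = η) (hθF : ∀ t : F, algebraMap F L t ≠ θ)
    (hηF : ∀ t : F, algebraMap F L t ≠ η) :
    ∃ a b : F, a ≠ 0 ∧ algebraMap F L a * θ + algebraMap F L b = η := by
  obtain ⟨g, hg, hsum⟩ := exists_sum_eq_zero_of_pow_card (F := F) (n := 2) (m := 3)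
    (by norm_num) (by norm_num) ![θ, 1, η]
    (by intro i; fin_cases i <;> simp [hθ, hη])
  simp only [Fin.sum_univ_three, Matrix.cons_val, mul_one] at hsum
  have h2 : g 2 ≠ 0 := by
    intro h2
    simp only [h2, map_zero, zero_mul, add_zero] at hsum
    by_cases h0 : g 0 = 0
    · have h1 : g 1 = 0 := by simpa [h0] using hsum
      exact hg (by ext i; fin_cases i <;> assumption)
    · refine hθF (-g 1 / g 0) ?_
      rw [map_div₀, map_neg, div_eq_iff (by simpa using h0)]
      linear_combination -hsum
  have h2' : algebraMap F L (g 2) ≠ 0 := by simpa using h2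
  refine ⟨-g 0 / g 2, -g 1 / g 2, ?_, ?_⟩
  · intro h0
    have h0 : g 0 = 0 := by simpa [h2] using h0
    refine hηF (-g 1 / g 2) ?_
    rw [map_div₀, map_neg, div_eq_iff h2']
    simp only [h0, map_zero, zero_mul, zero_add] at hsum
    linear_combination -hsum
  · simp only [map_div₀, map_neg]
    field_simp
    linear_combination -hsum

end FiniteField

/-! ### The cubic form of a point -/

section CubicForm

variable {F : Type*} [Field F]

/-- The polynomial whose zeros `t` are the parameters of the osculating planes through the point
with coordinate vector `x`, apart from `∞`. -/
noncomputable def pointPoly (x : Fin 4 → F) : Polynomial F :=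
  Cubic.toPoly ⟨-x 3, 3 * x 2, -3 * x 1, x 0⟩

theorem eval_pointPoly (x : Fin 4 → F) (t : F) :
    (pointPoly x).eval t = nullForm F (cubicHom t 1) x := by
  simp only [pointPoly, Cubic.toPoly, nullForm_apply, cubicHom, Matrix.cons_val]
  simp
  ring

variable {L : Type*} [Field L] [Algebra F L]

theorem aeval_pointPoly (x : Fin 4 → F) (θ : L) :
    Polynomial.aeval θ (pointPoly x) =
      nullForm L (cubicHom θ 1) (fun i => algebraMap F L (x i)) := by
  simp only [pointPoly, Cubic.toPoly, nullForm_apply, cubicHom, Matrix.cons_val]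
  simp [map_ofNat]
  ring

theorem symCube_algebraMap (a b c d : F) (x : Fin 4 → F) :
    symCube (algebraMap F L a) (algebraMap F L b) (algebraMap F L c) (algebraMap F L d)
      (fun i => algebraMap F L (x i)) = fun i => algebraMap F L (symCube a b c d x i) := by
  ext i; fin_cases i <;> simp [symCube_apply, map_ofNat]

theorem pointPoly_eq_zero (h3 : (3 : F) ≠ 0) {x : Fin 4 → F} (h : pointPoly x = 0) : x = 0 := by
  have h' := (Cubic.toPoly_injective _ _).1 (h.trans Cubic.zero.symm)
  simp only [Cubic.ext_iff] at h'
  obtain ⟨ha, hb, hc, hd⟩ := h'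
  change -x 3 = 0 at ha
  change 3 * x 2 = 0 at hb
  change -3 * x 1 = 0 at hc
  change x 0 = 0 at hd
  simp only [neg_eq_zero, mul_eq_zero, h3, false_or] at ha hb hc
  ext i; fin_cases i <;> assumption

/-- The covariance of the polynomial of a point: a zero `θ` is transformed by the same matrix as
the point. -/
theorem aeval_pointPoly_symCube {a b c d : F} {x : Fin 4 → F} {θ η : L}
    (hθ : Polynomial.aeval θ (pointPoly x) = 0)
    (hden : algebraMap F L c * θ + algebraMap F L d ≠ 0)
    (h : algebraMap F L a * θ + algebraMap F L b =
      (algebraMap F L c * θ + algebraMap F L d) * η) :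
    Polynomial.aeval η (pointPoly (symCube a b c d x)) = 0 := by
  rw [aeval_pointPoly] at *
  have key := nullForm_symCube (algebraMap F L a) (algebraMap F L b) (algebraMap F L c)
    (algebraMap F L d) (cubicHom θ 1) (fun i => algebraMap F L (x i))
  rw [hθ, mul_zero, symCube_algebraMap, symCube_cubicHom, mul_one, mul_one, h] at key
  set s := algebraMap F L c * θ + algebraMap F L d
  have hs : cubicHom (s * η) s = s ^ 3 • cubicHom η 1 := by
    ext i; fin_cases i <;> simp [cubicHom] <;> ring
  rw [hs, map_smul, LinearMap.smul_apply, smul_eq_mul, mul_eq_zero] at key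
  exact key.resolve_left (pow_ne_zero 3 hden)

theorem eq_zero_of_aeval_pointPoly (h3 : (3 : F) ≠ 0) {x : Fin 4 → F} {η : L}
    (hη : Polynomial.aeval η (pointPoly x) = 0)
    (hdeg : (pointPoly x).natDegree < (minpoly F η).natDegree) : x = 0 := by
  apply pointPoly_eq_zero h3
  by_contra hne
  exact absurd (Polynomial.natDegree_le_natDegree (minpoly.degree_le_of_ne_zero F η hne hη))
    (by omega)

theorem pointPoly_linear (r s : F) (x y : Fin 4 → F) :
    pointPoly (r • x - s • y) =
      Polynomial.C r * pointPoly x - Polynomial.C s * pointPoly y := by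
  simp only [pointPoly, Cubic.toPoly, Pi.sub_apply, Pi.smul_apply, smul_eq_mul]
  simp only [map_sub, map_mul, map_neg]
  ring

theorem natDegree_pointPoly_of_three {x : Fin 4 → F} (hx : x 3 ≠ 0) :
    (pointPoly x).natDegree = 3 :=
  Cubic.natDegree_of_a_ne_zero (P := ⟨-x 3, 3 * x 2, -3 * x 1, x 0⟩) (neg_ne_zero.2 hx)

theorem natDegree_pointPoly_of_two (h3 : (3 : F) ≠ 0) {x : Fin 4 → F} (hx : x 3 = 0)
    (hx2 : x 2 ≠ 0) : (pointPoly x).natDegree = 2 :=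
  Cubic.natDegree_of_b_ne_zero (P := ⟨-x 3, 3 * x 2, -3 * x 1, x 0⟩) (neg_eq_zero.2 hx)
    (mul_ne_zero h3 hx2)

theorem natDegree_pointPoly_le_two {x : Fin 4 → F} (hx : x 3 = 0) :
    (pointPoly x).natDegree ≤ 2 :=
  Cubic.natDegree_of_a_eq_zero (P := ⟨-x 3, 3 * x 2, -3 * x 1, x 0⟩) (neg_eq_zero.2 hx)

theorem natDegree_pointPoly_le_one {x : Fin 4 → F} (hx : x 3 = 0) (hx2 : x 2 = 0) :
    (pointPoly x).natDegree ≤ 1 :=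
  Cubic.natDegree_of_b_eq_zero (P := ⟨-x 3, 3 * x 2, -3 * x 1, x 0⟩) (neg_eq_zero.2 hx)
    (by simp [hx2])

theorem algebraMap_ne_of_natDegree {η : L} (h : 1 < (minpoly F η).natDegree) (t : F) :
    algebraMap F L t ≠ η := by
  rintro rfl
  rw [minpoly.eq_X_sub_C, Polynomial.natDegree_X_sub_C] at h
  exact lt_irrefl _ h

variable [Finite F]

/-- Two points whose cubic forms have no zeros over `F` are equivalent under `GL₂`. -/
theorem exists_symCube_eq_of_three (h3 : (3 : F) ≠ 0) {x y : Fin 4 → F} (hx3 : x 3 ≠ 0)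
    (hy3 : y 3 ≠ 0) (hx : ∀ t, nullForm F (cubicHom t 1) x ≠ 0)
    (hy : ∀ t, nullForm F (cubicHom t 1) y ≠ 0) :
    ∃ a b c d k : F, a * d - b * c ≠ 0 ∧ symCube a b c d x = k • y := by
  have dx := natDegree_pointPoly_of_three hx3
  have dy := natDegree_pointPoly_of_three hy3
  obtain ⟨θ, hθ⟩ := IsAlgClosed.exists_aeval_eq_zero (AlgebraicClosure F) (pointPoly x)
    (fun h => absurd (Polynomial.natDegree_eq_of_degree_eq_some h) (by rw [dx]; norm_num))
  obtain ⟨η, hη⟩ := IsAlgClosed.exists_aeval_eq_zero (AlgebraicClosure F) (pointPoly y)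
    (fun h => absurd (Polynomial.natDegree_eq_of_degree_eq_some h) (by rw [dy]; norm_num))
  have mθ := natDegree_minpoly_of_no_root (by rw [dx]; decide)
    (fun t ht => hx t (eval_pointPoly x t ▸ ht)) hθ
  have mη := natDegree_minpoly_of_no_root (by rw [dy]; decide)
    (fun t ht => hy t (eval_pointPoly y t ▸ ht)) hη
  have pθ := pow_card_pow_natDegree_minpoly (Algebra.IsIntegral.isIntegral (R := F) θ)
  have pη := pow_card_pow_natDegree_minpoly (Algebra.IsIntegral.isIntegral (R := F) η)
  rw [mθ, dx] at pθ
  rw [mη, dy] at pη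
  have nθ := algebraMap_ne_of_natDegree (show 1 < (minpoly F θ).natDegree by omega)
  have nη := algebraMap_ne_of_natDegree (show 1 < (minpoly F η).natDegree by omega)
  obtain ⟨a, b, c, d, hdet, hM⟩ := exists_mobius_of_pow_card pθ pη nθ nη
  have hden : algebraMap F (AlgebraicClosure F) c * θ + algebraMap F _ d ≠ 0 := by
    intro h0
    rw [h0, zero_mul] at hM
    apply hdet
    apply (algebraMap F (AlgebraicClosure F)).injective
    by_cases hc : c = 0
    · have hd : d = 0 := by simpa [hc] using h0
      simp [hc, hd]
    · exfalso
      refine nθ (-d / c) ?_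
      rw [map_div₀, map_neg, div_eq_iff (by simpa using hc)]
      linear_combination -h0
  have hz := aeval_pointPoly_symCube hθ hden hM
  set z := symCube a b c d x
  -- both polynomials are multiples of the minimal polynomial of `η`
  have hw : y 3 • z - z 3 • y = 0 := by
    refine eq_zero_of_aeval_pointPoly h3 (η := η) ?_ ?_
    · rw [pointPoly_linear, map_sub, map_mul, map_mul, hz, hη, mul_zero, mul_zero, sub_zero]
    · refine (natDegree_pointPoly_le_two ?_).trans_lt (by omega)
      simp [mul_comm]
  refine ⟨a, b, c, d, z 3 / y 3, hdet, ?_⟩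
  rw [div_eq_inv_mul, mul_smul, ← sub_eq_zero.1 hw, inv_smul_smul₀ hy3]

/-- Two points whose cubic forms have `∞` as their only zero, and as a simple one, are equivalent
under the affine group. -/
theorem exists_symCube_eq_of_two (h3 : (3 : F) ≠ 0) {x y : Fin 4 → F} (hx3 : x 3 = 0)
    (hy3 : y 3 = 0) (hx2 : x 2 ≠ 0) (hy2 : y 2 ≠ 0)
    (hx : ∀ t, nullForm F (cubicHom t 1) x ≠ 0) (hy : ∀ t, nullForm F (cubicHom t 1) y ≠ 0) :
    ∃ a b c d k : F, a * d - b * c ≠ 0 ∧ symCube a b c d x = k • y := by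
  have dx := natDegree_pointPoly_of_two h3 hx3 hx2
  have dy := natDegree_pointPoly_of_two h3 hy3 hy2
  obtain ⟨θ, hθ⟩ := IsAlgClosed.exists_aeval_eq_zero (AlgebraicClosure F) (pointPoly x)
    (fun h => absurd (Polynomial.natDegree_eq_of_degree_eq_some h) (by rw [dx]; norm_num))
  obtain ⟨η, hη⟩ := IsAlgClosed.exists_aeval_eq_zero (AlgebraicClosure F) (pointPoly y)
    (fun h => absurd (Polynomial.natDegree_eq_of_degree_eq_some h) (by rw [dy]; norm_num))
  have mθ := natDegree_minpoly_of_no_root (by rw [dx]; decide)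
    (fun t ht => hx t (eval_pointPoly x t ▸ ht)) hθ
  have mη := natDegree_minpoly_of_no_root (by rw [dy]; decide)
    (fun t ht => hy t (eval_pointPoly y t ▸ ht)) hη
  have pθ := pow_card_pow_natDegree_minpoly (Algebra.IsIntegral.isIntegral (R := F) θ)
  have pη := pow_card_pow_natDegree_minpoly (Algebra.IsIntegral.isIntegral (R := F) η)
  rw [mθ, dx] at pθ
  rw [mη, dy] at pη
  have nθ := algebraMap_ne_of_natDegree (show 1 < (minpoly F θ).natDegree by omega)
  have nη := algebraMap_ne_of_natDegree (show 1 < (minpoly F η).natDegree by omega)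
  obtain ⟨a, b, ha, hM⟩ := exists_affine_of_pow_card pθ pη nθ nη
  have hz := aeval_pointPoly_symCube (a := a) (b := b) (c := 0) (d := 1) hθ (by simp)
    (by simpa using hM)
  set z := symCube a b 0 1 x with hzdef
  have hz3 : z 3 = 0 := by simp [hzdef, symCube_apply, hx3]
  have hw : y 2 • z - z 2 • y = 0 := by
    refine eq_zero_of_aeval_pointPoly h3 (η := η) ?_ ?_
    · rw [pointPoly_linear, map_sub, map_mul, map_mul, hz, hη, mul_zero, mul_zero, sub_zero]
    · refine (natDegree_pointPoly_le_one ?_ ?_).trans_lt (by omega)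
      · simp [hz3, hy3]
      · simp [mul_comm]
  refine ⟨a, b, 0, 1, z 2 / y 2, by simpa using ha, ?_⟩
  rw [div_eq_inv_mul, mul_smul, ← sub_eq_zero.1 hw, inv_smul_smul₀ hy2]

end CubicForm

/-! ### Transport of incidence numbers -/

section Transport

variable {F : Type*} [Field F]

theorem numAbove_image (φ : Subsp F ≃o Subsp F) (S : Set (Subsp F)) (W : Subsp F) :
    numAbove (φ '' S) (φ W) = numAbove S W := by
  rw [numAbove, numAbove, ← Set.ncard_image_of_injective {U ∈ S | W ≤ U} φ.injective]
  congr 1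
  ext U
  constructor
  · rintro ⟨⟨U, hU, rfl⟩, h⟩
    exact ⟨U, ⟨hU, φ.le_iff_le.1 h⟩, rfl⟩
  · rintro ⟨U, ⟨hU, h⟩, rfl⟩
    exact ⟨⟨U, hU, rfl⟩, φ.le_iff_le.2 h⟩

theorem numBelow_image (φ : Subsp F ≃o Subsp F) (S : Set (Subsp F)) (W : Subsp F) :
    numBelow (φ '' S) (φ W) = numBelow S W := by
  rw [numBelow, numBelow, ← Set.ncard_image_of_injective {U ∈ S | U ≤ W} φ.injective]
  congr 1
  ext U
  constructor
  · rintro ⟨⟨U, hU, rfl⟩, h⟩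
    exact ⟨U, ⟨hU, φ.le_iff_le.1 h⟩, rfl⟩
  · rintro ⟨U, ⟨hU, h⟩, rfl⟩
    exact ⟨⟨U, hU, rfl⟩, φ.le_iff_le.2 h⟩

theorem numBelow_nullPolarity (h3 : (3 : F) ≠ 0) (S : Set (Subsp F)) (W : Subsp F) :
    numBelow (nullPolarity '' S) (nullPolarity W) = numAbove S W := by
  rw [numBelow, numAbove,
    ← Set.ncard_image_of_injective {U ∈ S | W ≤ U} (nullPolarity_injective h3)]
  congr 1
  ext U
  constructor
  · rintro ⟨⟨U, hU, rfl⟩, h⟩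
    exact ⟨U, ⟨hU, (nullPolarity_le_nullPolarity h3).1 h⟩, rfl⟩
  · rintro ⟨U, ⟨hU, h⟩, rfl⟩
    exact ⟨⟨U, hU, rfl⟩, nullPolarity_antitone h⟩

theorem image_image_nullPolarity (h3 : (3 : F) ≠ 0) (S : Set (Subsp F)) :
    nullPolarity '' (nullPolarity '' S) = S := by
  simp [Set.image_image, nullPolarity_nullPolarity h3]

theorem mem_image_nullPolarity (h3 : (3 : F) ≠ 0) {S : Set (Subsp F)} {W : Subsp F} :
    W ∈ nullPolarity '' S ↔ nullPolarity W ∈ S := by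
  constructor
  · rintro ⟨U, hU, rfl⟩
    rwa [nullPolarity_nullPolarity h3]
  · exact fun h => ⟨_, h, nullPolarity_nullPolarity h3 W⟩

theorem nullPolarity_image_cubic : nullPolarity '' cubic F = developable F := by
  rw [cubic, developable, ← Set.range_comp]
  congr 1
  exact funext nullPolarity_cubicPoint

theorem nullPolarity_image_developable (h3 : (3 : F) ≠ 0) :
    nullPolarity '' developable F = cubic F := by
  rw [← nullPolarity_image_cubic, image_image_nullPolarity h3]

theorem nullPolarity_mem_cubic (h3 : (3 : F) ≠ 0) {W : Subsp F} :
    nullPolarity W ∈ cubic F ↔ W ∈ developable F := by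
  rw [← nullPolarity_image_cubic, mem_image_nullPolarity h3]

theorem numBelow_cubic_nullPolarity (h3 : (3 : F) ≠ 0) (W : Subsp F) :
    numBelow (cubic F) (nullPolarity W) = numAbove (developable F) W := by
  rw [← nullPolarity_image_developable h3, numBelow_nullPolarity h3]

theorem numAbove_developable_nullPolarity (h3 : (3 : F) ≠ 0) (W : Subsp F) :
    numAbove (developable F) (nullPolarity W) = numBelow (cubic F) W := by
  rw [← numBelow_cubic_nullPolarity h3, nullPolarity_nullPolarity h3]

theorem finrank_nullPolarity_eq (h3 : (3 : F) ≠ 0) {W : Subsp F} {k l : ℕ} (h : k + l = 4) :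
    finrank F (nullPolarity W) = k ↔ finrank F W = l := by
  have := finrank_le_four W
  rw [finrank_nullPolarity h3]
  omega

theorem numAbove_developable (W : Subsp F) :
    numAbove (developable F) W = {t : Option F | W ≤ oscPlane t}.ncard := by
  rw [numAbove, ← Set.ncard_image_of_injective _ oscPlane_injective]
  congr 1
  ext U
  constructor
  · rintro ⟨⟨t, rfl⟩, h⟩
    exact ⟨t, h, rfl⟩
  · rintro ⟨t, h, rfl⟩
    exact ⟨⟨t, rfl⟩, h⟩

theorem numBelow_cubic (W : Subsp F) :
    numBelow (cubic F) W = {t : Option F | cubicPoint t ≤ W}.ncard := by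
  rw [numBelow, ← Set.ncard_image_of_injective _ cubicPoint_injective]
  congr 1
  ext U
  constructor
  · rintro ⟨⟨t, rfl⟩, h⟩
    exact ⟨t, h, rfl⟩
  · rintro ⟨t, h, rfl⟩
    exact ⟨⟨t, rfl⟩, h⟩

theorem numAbove_developable_cubicPoint (t : Option F) :
    numAbove (developable F) (cubicPoint t) = 1 := by
  rw [numAbove_developable, Set.ncard_eq_one]
  exact ⟨t, by ext s; simp [cubicPoint_le_oscPlane, eq_comm]⟩

theorem numAbove_developable_of_mem_cubic {W : Subsp F} (h : W ∈ cubic F) :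
    numAbove (developable F) W = 1 := by
  obtain ⟨t, rfl⟩ := h
  exact numAbove_developable_cubicPoint t

theorem span_le_oscPlane_none {x : Fin 4 → F} :
    Submodule.span F {x} ≤ oscPlane none ↔ x 3 = 0 := by
  rw [Submodule.span_singleton_le_iff_mem, ← nullPolarity_cubicPoint, ← param_zero 1,
    ← span_cubicHom (by simp), nullPolarity_span_singleton]
  simp [nullForm_apply, cubicHom]

theorem span_le_oscPlane_some {x : Fin 4 → F} {t : F} :
    Submodule.span F {x} ≤ oscPlane (some t) ↔ nullForm F (cubicHom t 1) x = 0 := by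
  rw [Submodule.span_singleton_le_iff_mem, ← nullPolarity_cubicPoint,
    show some t = param t 1 by simp [param], ← span_cubicHom (by simp),
    nullPolarity_span_singleton]

theorem nullForm_cubicHom_one (t : F) (x : Fin 4 → F) :
    nullForm F (cubicHom t 1) x = x 0 - 3 * t * x 1 + 3 * t ^ 2 * x 2 - t ^ 3 * x 3 := by
  simp only [nullForm_apply, cubicHom, Matrix.cons_val]
  ring

theorem exists_eq_span {P : Subsp F} (hP : finrank F P = 1) :
    ∃ x : Fin 4 → F, x ≠ 0 ∧ P = Submodule.span F {x} := by
  obtain ⟨v, hv, hspan⟩ := finrank_eq_one_iff'.1 hP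
  refine ⟨v, by simpa using hv, le_antisymm (fun w hw => ?_) ?_⟩
  · obtain ⟨c, hc⟩ := hspan ⟨w, hw⟩
    exact Submodule.mem_span_singleton.2 ⟨c, congrArg Subtype.val hc⟩
  · exact (Submodule.span_singleton_le_iff_mem _ _).2 v.2

end Transport

section Orbits

variable {F : Type*} [Field F]

/-- Equivalence of subspaces under `G_q`. -/
def CubicEquiv (W U : Subsp F) : Prop := ∃ φ ∈ cubicGroup F, φ W = U

theorem CubicEquiv.symm {W U : Subsp F} : CubicEquiv W U → CubicEquiv U W := by
  rintro ⟨φ, hφ, rfl⟩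
  exact ⟨φ⁻¹, inv_mem hφ, RelIso.inv_apply_self φ W⟩

theorem CubicEquiv.trans {W U V : Subsp F} : CubicEquiv W U → CubicEquiv U V → CubicEquiv W V := by
  rintro ⟨φ, hφ, rfl⟩ ⟨ψ, hψ, rfl⟩
  exact ⟨ψ * φ, mul_mem hψ hφ, rfl⟩

/-- A set of subspaces that is stable under `G_q`. -/
def IsStable (S : Set (Subsp F)) : Prop := ∀ φ ∈ cubicGroup F, ∀ W ∈ S, φ W ∈ S

theorem IsStable.image_eq {S : Set (Subsp F)} (hS : IsStable S) {φ : Subsp F ≃o Subsp F}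
    (hφ : φ ∈ cubicGroup F) : φ '' S = S := by
  refine Set.Subset.antisymm (by rintro _ ⟨W, hW, rfl⟩; exact hS φ hφ W hW) fun W hW => ?_
  exact ⟨φ⁻¹ W, hS _ (inv_mem hφ) W hW, RelIso.apply_inv_self φ W⟩

theorem IsStable.map_mem_iff {S : Set (Subsp F)} (hS : IsStable S) {φ : Subsp F ≃o Subsp F}
    (hφ : φ ∈ cubicGroup F) {W : Subsp F} : φ W ∈ S ↔ W ∈ S := by
  refine ⟨fun h => ?_, hS φ hφ W⟩
  have := hS _ (inv_mem hφ) _ h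
  rwa [RelIso.inv_apply_self] at this

theorem IsStable.numAbove_map {S : Set (Subsp F)} (hS : IsStable S) {φ : Subsp F ≃o Subsp F}
    (hφ : φ ∈ cubicGroup F) (W : Subsp F) : numAbove S (φ W) = numAbove S W := by
  conv_lhs => rw [← hS.image_eq hφ]
  exact numAbove_image φ S W

theorem IsStable.numBelow_map {S : Set (Subsp F)} (hS : IsStable S) {φ : Subsp F ≃o Subsp F}
    (hφ : φ ∈ cubicGroup F) (W : Subsp F) : numBelow S (φ W) = numBelow S W := by
  conv_lhs => rw [← hS.image_eq hφ]
  exact numBelow_image φ S W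

theorem finrank_map {φ : Subsp F ≃o Subsp F} (hφ : φ ∈ cubicGroup F) (W : Subsp F) :
    finrank F (φ W) = finrank F W := by
  obtain ⟨e, he⟩ := hφ.1
  rw [he]
  exact LinearEquiv.finrank_map_eq e W

theorem isStable_cubic : IsStable (cubic F) := fun φ hφ W hW => by
  rw [← hφ.2]
  exact Set.mem_image_of_mem φ hW

theorem IsOrbit.isStable {k : ℕ} {S : Set (Subsp F)} (hS : IsOrbit k S) : IsStable S := by
  obtain ⟨W, -, rfl⟩ := hS
  rintro φ hφ _ ⟨ψ, hψ, rfl⟩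
  exact ⟨φ * ψ, mul_mem hφ hψ, rfl⟩

theorem IsOrbit.cubicEquiv {k : ℕ} {S : Set (Subsp F)} (hS : IsOrbit k S) {U V : Subsp F}
    (hU : U ∈ S) (hV : V ∈ S) : CubicEquiv U V := by
  obtain ⟨W, -, rfl⟩ := hS
  obtain ⟨φ, hφ, rfl⟩ := hU
  obtain ⟨ψ, hψ, rfl⟩ := hV
  exact CubicEquiv.trans (CubicEquiv.symm ⟨φ, hφ, rfl⟩) ⟨ψ, hψ, rfl⟩

theorem isOrbit_of_cubicEquiv {k : ℕ} {S : Set (Subsp F)} (hS : IsStable S) {W : Subsp F}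
    (hW : W ∈ S) (hk : finrank F W = k) (h : ∀ U ∈ S, CubicEquiv U W) : IsOrbit k S := by
  refine ⟨W, hk, Set.Subset.antisymm (fun U hU => ?_) ?_⟩
  · obtain ⟨φ, hφ, hU⟩ := (h U hU).symm
    exact ⟨φ, hφ, hU.symm⟩
  · rintro _ ⟨φ, hφ, rfl⟩
    exact hS φ hφ W hW

theorem cubicEquiv_of_symCube {x y : Fin 4 → F} {a b c d k : F} (h : a * d - b * c ≠ 0)
    (hx : x ≠ 0) (hxy : symCube a b c d x = k • y) :
    CubicEquiv (Submodule.span F {x}) (Submodule.span F {y}) := by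
  refine ⟨symCubeIso a b c d h, symCubeIso_mem a b c d h, ?_⟩
  have hk : k ≠ 0 := by
    rintro rfl
    rw [zero_smul, ← symCubeEquiv_apply a b c d h, LinearEquiv.map_eq_zero_iff] at hxy
    exact hx hxy
  rw [symCubeIso_apply, Submodule.map_span, Set.image_singleton, hxy,
    Submodule.span_singleton_smul_eq (IsUnit.mk0 k hk)]

variable [Finite F]

/-- `G_q` is triply transitive on the osculating planes. -/
theorem exists_map_oscPlane (hq : 5 ≤ Nat.card F) {r s t : Option F} (hrs : r ≠ s) (hrt : r ≠ t)
    (hst : s ≠ t) : ∃ φ ∈ cubicGroup F, φ (oscPlane r) = oscPlane none ∧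
      φ (oscPlane s) = oscPlane (some 0) ∧ φ (oscPlane t) = oscPlane (some 1) := by
  obtain ⟨φ, hφ, h1, h2, h3⟩ := exists_mem_cubicGroup hrs hrt hst
  refine ⟨φ⁻¹, inv_mem hφ, ?_, ?_, ?_⟩
  · rw [← nullPolarity_cubicPoint, map_nullPolarity hq (inv_mem hφ), ← h1,
      RelIso.inv_apply_self, nullPolarity_cubicPoint]
  · rw [← nullPolarity_cubicPoint, map_nullPolarity hq (inv_mem hφ), ← h2,
      RelIso.inv_apply_self, nullPolarity_cubicPoint]
  · rw [← nullPolarity_cubicPoint, map_nullPolarity hq (inv_mem hφ), ← h3,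
      RelIso.inv_apply_self, nullPolarity_cubicPoint]

theorem exists_map_oscPlane_two (hq : 5 ≤ Nat.card F) {r s : Option F} (hrs : r ≠ s) :
    ∃ φ ∈ cubicGroup F, φ (oscPlane r) = oscPlane none ∧
      φ (oscPlane s) = oscPlane (some 0) := by
  classical
  obtain ⟨t, ht⟩ := exists_notMem_of_card_lt ({r, s} : Finset (Option F))
    (Finset.card_le_two.trans_lt (by rw [Finite.card_option]; omega))
  simp only [Finset.mem_insert, Finset.mem_singleton, not_or] at ht
  obtain ⟨φ, hφ, h1, h2, -⟩ := exists_map_oscPlane hq hrs (Ne.symm ht.1) (Ne.symm ht.2)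
  exact ⟨φ, hφ, h1, h2⟩

theorem exists_map_oscPlane_one (hq : 5 ≤ Nat.card F) (r : Option F) :
    ∃ φ ∈ cubicGroup F, φ (oscPlane r) = oscPlane none := by
  classical
  obtain ⟨t, ht⟩ := exists_notMem_of_card_lt ({r} : Finset (Option F))
    (by rw [Finset.card_singleton, Finite.card_option]; omega)
  obtain ⟨φ, hφ, h1, -⟩ := exists_map_oscPlane_two hq (Ne.symm (Finset.notMem_singleton.1 ht))
  exact ⟨φ, hφ, h1⟩

theorem isStable_image_nullPolarity (hq : 5 ≤ Nat.card F) {S : Set (Subsp F)} (hS : IsStable S) :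
    IsStable (nullPolarity '' S) := by
  rintro φ hφ _ ⟨W, hW, rfl⟩
  exact ⟨φ W, hS φ hφ W hW, (map_nullPolarity hq hφ W).symm⟩

theorem isStable_developable (hq : 5 ≤ Nat.card F) : IsStable (developable F) := by
  rw [← nullPolarity_image_cubic]
  exact isStable_image_nullPolarity hq isStable_cubic

theorem IsOrbit.image_nullPolarity (hq : 5 ≤ Nat.card F) (h3 : (3 : F) ≠ 0) {k l : ℕ}
    (hkl : l + k = 4) {S : Set (Subsp F)} (hS : IsOrbit k S) : IsOrbit l (nullPolarity '' S) := by
  obtain ⟨W, hW, hSW⟩ := id hS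
  have hWS : W ∈ S := hSW ▸ ⟨1, one_mem _, rfl⟩
  refine isOrbit_of_cubicEquiv (isStable_image_nullPolarity hq hS.isStable)
    ⟨W, hWS, rfl⟩ ((finrank_nullPolarity_eq h3 hkl).2 hW) ?_
  rintro _ ⟨U, hU, rfl⟩
  obtain ⟨φ, hφ, rfl⟩ := hS.cubicEquiv hU hWS
  exact ⟨φ, hφ, map_nullPolarity hq hφ U⟩

/-! ### The point orbits -/

omit [Finite F] in
theorem symCubeIso_tangentLine (h3 : (3 : F) ≠ 0) {a b c d : F} (h : a * d - b * c ≠ 0) {u v : F}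
    (huv : u ≠ 0 ∨ v ≠ 0) :
    symCubeIso a b c d h (tangentLine (param u v)) =
      tangentLine (param (a * u + b * v) (c * u + d * v)) := by
  rw [← span_cubicHom_partials h3 huv, ← span_cubicHom_partials h3 (mobius_ne_zero h huv),
    symCubeIso_apply, Submodule.map_span, Set.image_pair, symCube_cubicHomU, symCube_cubicHomV]
  refine Submodule.eq_of_le_of_finrank_le ?_ ?_
  · rw [Submodule.span_le, Set.pair_subset_iff]
    exact ⟨Submodule.mem_span_pair.2 ⟨a, c, rfl⟩, Submodule.mem_span_pair.2 ⟨b, d, rfl⟩⟩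
  · apply Submodule.finrank_mono
    rw [Submodule.span_le, Set.pair_subset_iff]
    set x := cubicHomU (a * u + b * v) (c * u + d * v)
    set y := cubicHomV (a * u + b * v) (c * u + d * v)
    set D := a * d - b * c with hD
    refine ⟨Submodule.mem_span_pair.2 ⟨d / D, -c / D, ?_⟩,
      Submodule.mem_span_pair.2 ⟨-b / D, a / D, ?_⟩⟩
    · have e1 : d / D * a + -c / D * b = 1 := by field_simp; rw [hD]; ring
      have e2 : d / D * c + -c / D * d = 0 := by field_simp; ring
      rw [smul_add, smul_add, add_add_add_comm, smul_smul, smul_smul, smul_smul, smul_smul,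
        ← add_smul, ← add_smul, e1, e2, one_smul, zero_smul, add_zero]
    · have e1 : -b / D * a + a / D * b = 0 := by field_simp; ring
      have e2 : -b / D * c + a / D * d = 1 := by field_simp; rw [hD]; ring
      rw [smul_add, smul_add, add_add_add_comm, smul_smul, smul_smul, smul_smul, smul_smul,
        ← add_smul, ← add_smul, e1, e2, one_smul, zero_smul, zero_add]

theorem map_tangentLine (hq : 5 ≤ Nat.card F) (h3 : (3 : F) ≠ 0) {φ : Subsp F ≃o Subsp F}
    (hφ : φ ∈ cubicGroup F) {s t : Option F} (hst : φ (oscPlane s) = oscPlane t) :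
    φ (tangentLine s) = tangentLine t := by
  rw [← nullPolarity_cubicPoint, ← nullPolarity_cubicPoint, map_nullPolarity hq hφ] at hst
  replace hst := nullPolarity_injective h3 hst
  obtain ⟨a, b, c, d, h, rfl⟩ := exists_eq_symCubeIso hq hφ
  obtain ⟨u, v, huv, rfl⟩ := exists_param s
  rw [symCubeIso_cubicPoint h huv] at hst
  rw [symCubeIso_tangentLine h3 h huv, cubicPoint_injective hst]

theorem isStable_tangents (hq : 5 ≤ Nat.card F) (h3 : (3 : F) ≠ 0) : IsStable (tangents F) := by
  rintro φ hφ _ ⟨t, rfl⟩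
  obtain ⟨s, hs⟩ := isStable_developable hq φ hφ _ ⟨t, rfl⟩
  exact ⟨s, (map_tangentLine hq h3 hφ hs.symm).symm⟩

theorem isOrbit_cubic (hq : 5 ≤ Nat.card F) (h3 : (3 : F) ≠ 0) : IsOrbit 1 (cubic F) := by
  refine isOrbit_of_cubicEquiv isStable_cubic ⟨none, rfl⟩ (finrank_cubicPoint none) ?_
  rintro _ ⟨t, rfl⟩
  obtain ⟨φ, hφ, h⟩ := exists_map_oscPlane_one hq t
  rw [← nullPolarity_cubicPoint, ← nullPolarity_cubicPoint, map_nullPolarity hq hφ] at h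
  exact ⟨φ, hφ, nullPolarity_injective h3 h⟩

/-- The points off the cubic on exactly `n` osculating planes. -/
def pointsOn (F : Type*) [Field F] (n : ℕ) : Set (Subsp F) :=
  {P | finrank F P = 1 ∧ P ∉ cubic F ∧ numAbove (developable F) P = n}

theorem isStable_pointsOn (hq : 5 ≤ Nat.card F) (n : ℕ) : IsStable (pointsOn F n) := by
  rintro φ hφ P ⟨h1, h2, h3⟩
  exact ⟨(finrank_map hφ P).trans h1, fun h => h2 ((isStable_cubic.map_mem_iff hφ).1 h),
    ((isStable_developable hq).numAbove_map hφ P).trans h3⟩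

omit [Finite F] in
theorem mem_pointsOn_of_ne {n : ℕ} (hn : n ≠ 1) {x : Fin 4 → F} (hx : x ≠ 0)
    (h : {t : Option F | Submodule.span F {x} ≤ oscPlane t}.ncard = n) :
    Submodule.span F {x} ∈ pointsOn F n := by
  rw [← numAbove_developable] at h
  exact ⟨finrank_span_singleton hx,
    fun hc => hn (h.symm.trans (numAbove_developable_of_mem_cubic hc)), h⟩

theorem isOrbit_pointsOn_three (hq : 5 ≤ Nat.card F) (h3 : (3 : F) ≠ 0) :
    IsOrbit 1 (pointsOn F 3) := by
  have hx : (![0, 1, 1, 0] : Fin 4 → F) ≠ 0 := fun h => by simpa using congrFun h 1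
  refine isOrbit_of_cubicEquiv (isStable_pointsOn hq 3) (mem_pointsOn_of_ne (by norm_num) hx ?_)
    (finrank_span_singleton hx) ?_
  · rw [Set.ncard_eq_three]
    refine ⟨none, some 0, some 1, by simp, by simp, by simp, ?_⟩
    ext t
    cases t with
    | none => simp [-Submodule.span_singleton_le_iff_mem, span_le_oscPlane_none]
    | some t =>
      have e : (-(3 * t) + 3 * t ^ 2 : F) = 3 * (t * (t - 1)) := by ring
      simp [-Submodule.span_singleton_le_iff_mem, span_le_oscPlane_some,
        nullForm_cubicHom_one, e, h3, sub_eq_zero]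
  · rintro P ⟨hP, -, hn⟩
    rw [numAbove_developable, Set.ncard_eq_three] at hn
    obtain ⟨r, s, t, hrs, hrt, hst, heq⟩ := hn
    obtain ⟨φ, hφ, hr, hs, ht⟩ := exists_map_oscPlane hq hrs hrt hst
    have hPr : P ≤ oscPlane r := (Set.ext_iff.1 heq r).2 (by simp)
    have hPs : P ≤ oscPlane s := (Set.ext_iff.1 heq s).2 (by simp)
    have hPt : P ≤ oscPlane t := (Set.ext_iff.1 heq t).2 (by simp)
    refine ⟨φ, hφ, ?_⟩
    obtain ⟨x, hx0, hPx⟩ := exists_eq_span ((finrank_map hφ P).trans hP)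
    rw [← φ.le_iff_le, hr, hPx, span_le_oscPlane_none] at hPr
    rw [← φ.le_iff_le, hs, hPx, span_le_oscPlane_some, nullForm_cubicHom_one] at hPs
    rw [← φ.le_iff_le, ht, hPx, span_le_oscPlane_some, nullForm_cubicHom_one] at hPt
    have h0 : x 0 = 0 := by simpa using hPs
    have h12 : x 2 = x 1 := by
      refine mul_left_cancel₀ h3 ?_
      linear_combination hPt - h0 + hPr
    have hxe : x = x 1 • ![0, 1, 1, 0] := by
      ext i; fin_cases i <;> simp [h0, h12, hPr]
    have hx1 : x 1 ≠ 0 := fun h => hx0 (by rw [hxe, h, zero_smul])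
    rw [hPx, hxe, Submodule.span_singleton_smul_eq (IsUnit.mk0 _ hx1)]

theorem cubicEquiv_of_le_tangent (hq : 5 ≤ Nat.card F) (h3 : (3 : F) ≠ 0) {P : Subsp F}
    (hP : finrank F P = 1) (hc : P ∉ cubic F) {t : Option F} (ht : P ≤ tangentLine t) :
    CubicEquiv P (Submodule.span F {![0, 1, 0, 0]}) := by
  obtain ⟨φ, hφ, hφt⟩ := exists_map_oscPlane_one hq t
  have hle := φ.le_iff_le.2 ht
  rw [map_tangentLine hq h3 hφ hφt] at hle
  have hc' : φ P ∉ cubic F := fun h => hc ((isStable_cubic.map_mem_iff hφ).1 h)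
  obtain ⟨x, hx0, hPx⟩ := exists_eq_span ((finrank_map hφ P).trans hP)
  refine CubicEquiv.trans ⟨φ, hφ, hPx⟩ ?_
  rw [hPx, Submodule.span_singleton_le_iff_mem] at hle
  obtain ⟨a, b, rfl⟩ := Submodule.mem_span_pair.1 hle
  have hb : b ≠ 0 := by
    rintro rfl
    have ha : a ≠ 0 := by
      rintro rfl
      simp at hx0
    refine hc' ⟨none, ?_⟩
    rw [hPx, zero_smul, add_zero, Submodule.span_singleton_smul_eq (IsUnit.mk0 _ ha)]
    rfl
  -- a translation of the parameter moves along the tangent at `∞`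
  refine cubicEquiv_of_symCube (a := 1) (b := -a / (3 * b)) (c := 0) (d := 1) (k := b)
    (by simp) hx0 ?_
  ext i; fin_cases i <;> simp [symCube_apply]
  field_simp
  ring

omit [Finite F] in
theorem numAbove_developable_tangent (h3 : (3 : F) ≠ 0) :
    numAbove (developable F) (Submodule.span F {![0, 1, 0, 0]}) = 2 := by
  rw [numAbove_developable, Set.ncard_eq_two]
  refine ⟨none, some 0, by simp, ?_⟩
  ext t
  cases t with
  | none => simp [-Submodule.span_singleton_le_iff_mem, span_le_oscPlane_none]
  | some t => simp [-Submodule.span_singleton_le_iff_mem, span_le_oscPlane_some,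
      nullForm_cubicHom_one, h3]

/-- A cubic form with a double zero that is not triple has exactly two zeros, and conversely: the
points on exactly two osculating planes are those on the tangents and off the cubic. -/
theorem pointsOfType_T (hq : 5 ≤ Nat.card F) (h3 : (3 : F) ≠ 0) :
    pointsOfType F .T = pointsOn F 2 := by
  ext P
  constructor
  · rintro ⟨hP, hc, _, ⟨t, rfl⟩, ht⟩
    refine ⟨hP, hc, ?_⟩
    obtain ⟨φ, hφ, h⟩ := cubicEquiv_of_le_tangent hq h3 hP hc ht
    rw [← (isStable_developable hq).numAbove_map hφ, h, numAbove_developable_tangent h3]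
  · rintro ⟨hP, hc, hn⟩
    refine ⟨hP, hc, ?_⟩
    obtain ⟨r, s, hrs, heq⟩ := Set.ncard_eq_two.1 ((numAbove_developable P).symm.trans hn)
    obtain ⟨φ, hφ, hr, hs⟩ := exists_map_oscPlane_two hq hrs
    have hPr : P ≤ oscPlane r := (Set.ext_iff.1 heq r).2 (by simp)
    have hPs : P ≤ oscPlane s := (Set.ext_iff.1 heq s).2 (by simp)
    obtain ⟨x, hx0, hPx⟩ := exists_eq_span ((finrank_map hφ P).trans hP)
    rw [← (isStable_developable hq).numAbove_map hφ, hPx, numAbove_developable] at hn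
    rw [← φ.le_iff_le, hr, hPx, span_le_oscPlane_none] at hPr
    rw [← φ.le_iff_le, hs, hPx, span_le_oscPlane_some, nullForm_cubicHom_one] at hPs
    have h0 : x 0 = 0 := by simpa using hPs
    suffices h : ∃ ℓ ∈ tangents F, φ P ≤ ℓ by
      obtain ⟨ℓ, hℓ, hle⟩ := h
      refine ⟨φ⁻¹ ℓ, isStable_tangents hq h3 _ (inv_mem hφ) ℓ hℓ, ?_⟩
      rwa [← φ.le_iff_le, RelIso.apply_inv_self]
    rw [hPx]
    simp only [Submodule.span_singleton_le_iff_mem]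
    by_cases h1 : x 1 = 0
    · refine ⟨_, ⟨some 0, rfl⟩, Submodule.mem_span_pair.2 ⟨0, x 2, ?_⟩⟩
      ext i; fin_cases i <;> simp [h0, h1, hPr]
    by_cases h2 : x 2 = 0
    · refine ⟨_, ⟨none, rfl⟩, Submodule.mem_span_pair.2 ⟨0, x 1, ?_⟩⟩
      ext i; fin_cases i <;> simp [h0, h2, hPr]
    -- otherwise there is a third zero
    exfalso
    have hsub : ({none, some 0, some (x 1 / x 2)} : Set (Option F)) ⊆
        {t : Option F | Submodule.span F {x} ≤ oscPlane t} := by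
      rintro _ (rfl | rfl | rfl)
      · exact span_le_oscPlane_none.2 hPr
      · exact span_le_oscPlane_some.2 (by rw [nullForm_cubicHom_one]; simp [h0])
      · refine span_le_oscPlane_some.2 ?_
        rw [nullForm_cubicHom_one, h0, hPr]
        field_simp
        ring
    have hle := Set.ncard_le_ncard hsub (Set.toFinite _)
    rw [hn, Set.ncard_eq_three.2 ⟨none, some 0, some (x 1 / x 2), by simp, by simp,
      fun h => div_ne_zero h1 h2 (Option.some_injective _ h).symm, rfl⟩] at hle
    omega

theorem isOrbit_pointsOn_two (hq : 5 ≤ Nat.card F) (h3 : (3 : F) ≠ 0) :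
    IsOrbit 1 (pointsOn F 2) := by
  have hx : (![0, 1, 0, 0] : Fin 4 → F) ≠ 0 := fun h => by simpa using congrFun h 1
  refine isOrbit_of_cubicEquiv (isStable_pointsOn hq 2) (mem_pointsOn_of_ne (by norm_num) hx ?_)
    (finrank_span_singleton hx) ?_
  · rw [← numAbove_developable, numAbove_developable_tangent h3]
  · intro P hP
    rw [← pointsOfType_T hq h3] at hP
    obtain ⟨hP, hc, _, ⟨t, rfl⟩, ht⟩ := hP
    exact cubicEquiv_of_le_tangent hq h3 hP hc ht

theorem isOrbit_pointsOn_zero (hq : 5 ≤ Nat.card F) (h3 : (3 : F) ≠ 0) :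
    IsOrbit 1 (pointsOn F 0) := by
  have normal : ∀ x : Fin 4 → F, (Submodule.span F {x} ∈ pointsOn F 0) →
      x 3 ≠ 0 ∧ ∀ t, nullForm F (cubicHom t 1) x ≠ 0 := by
    rintro x ⟨-, -, hn⟩
    rw [numAbove_developable, Set.ncard_eq_zero, Set.eq_empty_iff_forall_notMem] at hn
    exact ⟨fun h => hn none (span_le_oscPlane_none.2 h),
      fun t h => hn (some t) (span_le_oscPlane_some.2 h)⟩
  obtain ⟨c, hc⟩ := exists_forall_cube_sub_ne (F := F)
  have hx : (![-c, 1 / 3, 0, -1] : Fin 4 → F) ≠ 0 := fun h => by simpa using congrFun h 3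
  have hmem : Submodule.span F {![-c, 1 / 3, 0, -1]} ∈ pointsOn F 0 := by
    refine mem_pointsOn_of_ne (by norm_num) hx ?_
    rw [Set.ncard_eq_zero, Set.eq_empty_iff_forall_notMem]
    intro t ht
    cases t with
    | none => simpa using span_le_oscPlane_none.1 ht
    | some t =>
      have h := span_le_oscPlane_some.1 ht
      rw [nullForm_cubicHom_one] at h
      refine hc t ?_
      simp only [Matrix.cons_val] at h
      field_simp at h
      linear_combination h
  refine isOrbit_of_cubicEquiv (isStable_pointsOn hq 0) hmem (finrank_span_singleton hx) ?_
  intro P hP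
  obtain ⟨x, hx0, rfl⟩ := exists_eq_span hP.1
  obtain ⟨a, b, c', d, k, hdet, h⟩ := exists_symCube_eq_of_three h3 (normal _ hP).1
    (normal _ hmem).1 (normal _ hP).2 (normal _ hmem).2
  exact cubicEquiv_of_symCube hdet hx0 h

theorem isOrbit_pointsOn_one (hq : 5 ≤ Nat.card F) (h3 : (3 : F) ≠ 0) :
    IsOrbit 1 (pointsOn F 1) := by
  have normal : ∀ x : Fin 4 → F, (Submodule.span F {x} ∈ pointsOn F 1) → x 3 = 0 →
      x 2 ≠ 0 ∧ ∀ t, nullForm F (cubicHom t 1) x ≠ 0 := by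
    rintro x ⟨hr, hxc, hn⟩ hx3
    have hx0 : x ≠ 0 := by
      rintro rfl
      rw [Submodule.span_zero_singleton, finrank_bot] at hr
      exact zero_ne_one hr
    rw [numAbove_developable, Set.ncard_eq_one] at hn
    obtain ⟨r, hn⟩ := hn
    have hnone := (Set.ext_iff.1 hn none).1 (span_le_oscPlane_none.2 hx3)
    have hroot : ∀ t, nullForm F (cubicHom t 1) x ≠ 0 := by
      intro t ht
      have hsome := (Set.ext_iff.1 hn (some t)).1 (span_le_oscPlane_some.2 ht)
      rw [Set.mem_singleton_iff] at hnone hsome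
      exact absurd (hnone.trans hsome.symm) (by simp)
    refine ⟨fun hx2 => ?_, hroot⟩
    by_cases hx1 : x 1 = 0
    · have hx00 : x 0 ≠ 0 := fun h => hx0 (by ext i; fin_cases i <;> assumption)
      refine hxc ⟨none, ?_⟩
      rw [cubicPoint, ← Submodule.span_singleton_smul_eq (IsUnit.mk0 (x 0) hx00)]
      congr 2
      ext i; fin_cases i <;> simp [cubicVec, hx1, hx2, hx3]
    · refine hroot (x 0 / (3 * x 1)) ?_
      rw [nullForm_cubicHom_one, hx2, hx3]
      field_simp
      ring
  obtain ⟨c, hc⟩ := exists_forall_sq_sub_ne (F := F)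
  have hx : (![-3 * c, 1, 1, 0] : Fin 4 → F) ≠ 0 := fun h => by simpa using congrFun h 2
  have hmem : Submodule.span F {![-3 * c, 1, 1, 0]} ∈ pointsOn F 1 := by
    refine ⟨finrank_span_singleton hx, ?_, ?_⟩
    · rintro ⟨t, ht⟩
      have hle := (cubicPoint_le_oscPlane t none).1 (ht ▸ span_le_oscPlane_none.2 (by simp))
      subst hle
      have hmem : (![-3 * c, 1, 1, 0] : Fin 4 → F) ∈ cubicPoint none :=
        ht ▸ Submodule.mem_span_singleton_self _
      obtain ⟨a, ha⟩ := Submodule.mem_span_singleton.1 hmem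
      simpa [cubicVec] using congrFun ha 1
    · rw [numAbove_developable, Set.ncard_eq_one]
      refine ⟨none, ?_⟩
      ext t
      cases t with
      | none => simp [-Submodule.span_singleton_le_iff_mem, span_le_oscPlane_none]
      | some t =>
        simp only [Set.mem_ofPred_eq, Set.mem_singleton_iff, reduceCtorEq, iff_false]
        intro ht
        have h := span_le_oscPlane_some.1 ht
        rw [nullForm_cubicHom_one] at h
        refine hc t ?_
        simp only [Matrix.cons_val] at h
        refine mul_left_cancel₀ h3 ?_
        linear_combination h
  refine isOrbit_of_cubicEquiv (isStable_pointsOn hq 1) hmem (finrank_span_singleton hx) ?_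
  intro P hP
  obtain ⟨r, hr⟩ := Set.ncard_eq_one.1 ((numAbove_developable P).symm.trans hP.2.2)
  have hPr : P ≤ oscPlane r := (Set.ext_iff.1 hr r).2 rfl
  obtain ⟨φ, hφ, hφr⟩ := exists_map_oscPlane_one hq r
  have hφP := isStable_pointsOn hq 1 φ hφ P hP
  obtain ⟨x, hx0, hPx⟩ := exists_eq_span hφP.1
  rw [← φ.le_iff_le, hφr, hPx, span_le_oscPlane_none] at hPr
  refine CubicEquiv.trans ⟨φ, hφ, hPx⟩ ?_
  rw [hPx] at hφP
  obtain ⟨a, b, c', d, k, hdet, h⟩ := exists_symCube_eq_of_two h3 hPr (by simp)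
    (normal _ hφP hPr).1 (normal _ hmem (by simp)).1 (normal _ hφP hPr).2
    (normal _ hmem (by simp)).2
  exact cubicEquiv_of_symCube hdet hx0 h

/-! ### Duality of point types and plane types -/

omit [Finite F] in
theorem image_pointsOn (h3 : (3 : F) ≠ 0) (n : ℕ) :
    nullPolarity '' pointsOn F n =
      {p : Subsp F | finrank F p = 3 ∧ p ∉ developable F ∧ numBelow (cubic F) p = n} := by
  ext p
  rw [mem_image_nullPolarity h3]
  change finrank F (nullPolarity p) = 1 ∧ nullPolarity p ∉ cubic F ∧
    numAbove (developable F) (nullPolarity p) = n ↔ _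
  rw [finrank_nullPolarity_eq h3 (l := 3) rfl, nullPolarity_mem_cubic h3,
    numAbove_developable_nullPolarity h3]
  rfl

omit [Finite F] in
theorem numBelow_cubic_of_mem_developable (h3 : (3 : F) ≠ 0) {p : Subsp F}
    (hp : p ∈ developable F) : numBelow (cubic F) p = 1 := by
  rw [← numAbove_developable_nullPolarity h3]
  exact numAbove_developable_of_mem_cubic ((nullPolarity_mem_cubic h3).2 hp)

omit [Finite F] in
theorem image_pointsOn_of_ne (h3 : (3 : F) ≠ 0) {n : ℕ} (hn : n ≠ 1) :
    nullPolarity '' pointsOn F n = {p : Subsp F | finrank F p = 3 ∧ numBelow (cubic F) p = n} := by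
  rw [image_pointsOn h3]
  ext p
  exact ⟨fun h => ⟨h.1, h.2.2⟩, fun h => ⟨h.1, fun hp =>
    hn (h.2.symm.trans (numBelow_cubic_of_mem_developable h3 hp)), h.2⟩⟩

/-- Every plane type is the image of a point type that forms a single orbit. -/
theorem exists_isOrbit_image_eq_planesOfType (hq : 5 ≤ Nat.card F) (h3 : (3 : F) ≠ 0)
    (p : PlaneType) :
    ∃ M : Set (Subsp F), IsOrbit 1 M ∧ nullPolarity '' M = planesOfType F p := by
  cases p with
  | Γ => exact ⟨_, isOrbit_cubic hq h3, nullPolarity_image_cubic⟩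
  | twoC => exact ⟨_, isOrbit_pointsOn_two hq h3, image_pointsOn_of_ne h3 (by norm_num)⟩
  | threeC => exact ⟨_, isOrbit_pointsOn_three hq h3, image_pointsOn_of_ne h3 (by norm_num)⟩
  | oneC => exact ⟨_, isOrbit_pointsOn_one hq h3, image_pointsOn h3 1⟩
  | zeroC => exact ⟨_, isOrbit_pointsOn_zero hq h3, image_pointsOn_of_ne h3 (by norm_num)⟩

end Orbits

/-! ### Extension of scalars -/

section Extension

variable {F : Type*} [Field F] {K : Type*} [Field K] [Algebra F K]

variable (K) in
theorem three_ne_zero_of_algebra (h3 : (3 : F) ≠ 0) : (3 : K) ≠ 0 := by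
  have h := (algebraMap F K).injective.ne h3
  rwa [map_zero, map_ofNat] at h

theorem algebraMap_mem_extendScalars {W : Subsp F} {v : Fin 4 → F} (hv : v ∈ W) :
    (fun i => algebraMap F K (v i)) ∈ extendScalars K W :=
  Submodule.subset_span ⟨v, hv, rfl⟩

theorem extendScalars_le {W : Subsp F} {U : Subsp K} :
    extendScalars K W ≤ U ↔ ∀ v ∈ W, (fun i => algebraMap F K (v i)) ∈ U := by
  rw [extendScalars, Submodule.span_le]
  exact Set.image_subset_iff

theorem extendScalars_mono {W U : Subsp F} (h : W ≤ U) : extendScalars K W ≤ extendScalars K U :=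
  extendScalars_le.2 fun _ hv => algebraMap_mem_extendScalars (h hv)

theorem finrank_extendScalars_le (W : Subsp F) :
    finrank K (extendScalars K W) ≤ finrank F W := by
  set b := Module.finBasis F W
  have hle : extendScalars K W ≤
      Submodule.span K (Set.range fun j => fun i => algebraMap F K ((b j : Fin 4 → F) i)) := by
    rw [extendScalars_le]
    intro v hv
    have hsum := congrArg Subtype.val (b.sum_repr ⟨v, hv⟩)
    have hv' : (fun i => algebraMap F K (v i)) = ∑ j, algebraMap F K (b.repr ⟨v, hv⟩ j) •
        fun i => algebraMap F K ((b j : Fin 4 → F) i) := by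
      ext i
      have := congrFun hsum i
      simp only [AddSubmonoidClass.coe_finsetSum, Submodule.coe_smul, Finset.sum_apply,
        Pi.smul_apply, smul_eq_mul] at this
      simp [← this, Algebra.smul_def]
    rw [hv']
    exact Submodule.sum_mem _ fun j _ => Submodule.smul_mem _ _ (Submodule.subset_span ⟨j, rfl⟩)
  refine (Submodule.finrank_mono hle).trans ((finrank_range_le_card _).trans ?_)
  simp

theorem finrank_extendScalars (W : Subsp F) :
    finrank K (extendScalars K W) = finrank F W := by
  -- a complement of `W` turns the upper bound into a lower bound
  obtain ⟨U, hU⟩ := Submodule.exists_isCompl W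
  have htop : extendScalars K W ⊔ extendScalars K U = ⊤ := by
    rw [eq_top_iff, ← (Pi.basisFun K (Fin 4)).span_eq, Submodule.span_le]
    rintro _ ⟨i, rfl⟩
    obtain ⟨w, hw, u, hu, h⟩ := Submodule.mem_sup.1
      (hU.sup_eq_top ▸ Submodule.mem_top : (Pi.single i 1 : Fin 4 → F) ∈ W ⊔ U)
    refine Submodule.mem_sup.2 ⟨_, algebraMap_mem_extendScalars hw, _,
      algebraMap_mem_extendScalars hu, ?_⟩
    ext j
    have := congrArg (algebraMap F K) (congrFun h j)
    rw [Pi.add_apply, map_add] at this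
    rw [Pi.add_apply, this, Pi.basisFun_apply]
    simp only [Pi.single_apply]
    split_ifs <;> simp
  have h1 := Submodule.finrank_add_le_finrank_add_finrank (extendScalars K W) (extendScalars K U)
  rw [htop, finrank_top, Module.finrank_fin_fun] at h1
  have h2 := Submodule.finrank_add_eq_of_isCompl hU
  rw [Module.finrank_fin_fun] at h2
  have h3 := finrank_extendScalars_le (K := K) W
  have h4 := finrank_extendScalars_le (K := K) U
  omega

theorem extendScalars_nullPolarity (h3 : (3 : F) ≠ 0) (W : Subsp F) :
    extendScalars K (nullPolarity W) = nullPolarity (extendScalars K W) := by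
  have h3K := three_ne_zero_of_algebra K h3
  refine Submodule.eq_of_le_of_finrank_eq ?_ ?_
  · rw [le_nullPolarity_comm, extendScalars_le]
    intro v hv
    rw [mem_nullPolarity]
    intro y hy
    suffices h : extendScalars K (nullPolarity W) ≤
        nullPolarity (Submodule.span K {fun i => algebraMap F K (v i)}) by
      rw [nullForm_swap, (nullPolarity_span_singleton _).1 (h hy), neg_zero]
    rw [extendScalars_le]
    intro w hw
    have h := congrArg (algebraMap F K) (mem_nullPolarity.1 hw v hv)
    rw [nullPolarity_span_singleton]
    simpa [nullForm_apply, map_ofNat] using h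
  · rw [finrank_extendScalars, finrank_nullPolarity h3, finrank_nullPolarity h3K,
      finrank_extendScalars]

theorem extendScalars_map_symCube (a b c d : F) (W : Subsp F) :
    extendScalars K (W.map (symCube a b c d)) = (extendScalars K W).map
      (symCube (algebraMap F K a) (algebraMap F K b) (algebraMap F K c) (algebraMap F K d)) := by
  rw [extendScalars, extendScalars, Submodule.map_span, Submodule.map_coe, Set.image_image,
    Set.image_image]
  simp only [symCube_algebraMap]

theorem extendScalars_oscPlane_le (t : Option F) :
    extendScalars K (oscPlane t) ≤ oscPlane (t.map (algebraMap F K)) := by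
  rw [extendScalars_le]
  intro v hv
  cases t with
  | none =>
    have h : 0 * v 0 + 0 * v 1 + 0 * v 2 + 1 * v 3 = 0 := hv
    change 0 * algebraMap F K (v 0) + 0 * algebraMap F K (v 1) + 0 * algebraMap F K (v 2) +
      1 * algebraMap F K (v 3) = 0
    simpa using h
  | some t =>
    have h : 1 * v 0 + -3 * t * v 1 + 3 * t ^ 2 * v 2 + -t ^ 3 * v 3 = 0 := hv
    change 1 * algebraMap F K (v 0) + -3 * algebraMap F K t * algebraMap F K (v 1) +
      3 * algebraMap F K t ^ 2 * algebraMap F K (v 2) +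
        -algebraMap F K t ^ 3 * algebraMap F K (v 3) = 0
    simpa [map_ofNat] using congrArg (algebraMap F K) h

theorem cubicPoint_le_extendScalars {t : Option F} {W : Subsp F} (h : cubicPoint t ≤ W) :
    cubicPoint (t.map (algebraMap F K)) ≤ extendScalars K W := by
  rw [cubicPoint, Submodule.span_singleton_le_iff_mem] at h ⊢
  convert algebraMap_mem_extendScalars (K := K) h using 1
  cases t <;> ext i <;> fin_cases i <;> simp [cubicVec]

/-- No three points of the cubic are collinear. -/
theorem not_cubicPoint_le_sup {r s t : Option K} (hrs : r ≠ s) (hrt : r ≠ t) (hst : s ≠ t) :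
    ¬ cubicPoint r ≤ cubicPoint s ⊔ cubicPoint t := by
  intro h
  obtain ⟨a, b, c, d, hdet, hr, hs, ht⟩ := exists_matrix_param hrs hrt hst
  rw [← hr, ← hs, ← ht, ← symCubeIso_cubicPoint_none hdet, ← symCubeIso_cubicPoint_zero hdet,
    ← symCubeIso_cubicPoint_one hdet, ← OrderIso.map_sup, OrderIso.le_iff_le] at h
  rw [cubicPoint, cubicPoint, cubicPoint, ← Submodule.span_insert,
    Submodule.span_singleton_le_iff_mem] at h
  obtain ⟨x, y, hxy⟩ := Submodule.mem_span_pair.1 h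
  have h0 := congrFun hxy 0
  have h1 := congrFun hxy 1
  simp [cubicVec] at h0 h1
  exact zero_ne_one (h1.symm.trans h0)

theorem finrank_cubicPoint_sup {s t : Option K} (hst : s ≠ t) :
    finrank K (cubicPoint s ⊔ cubicPoint t : Subsp K) = 2 := by
  have hinf : (cubicPoint s ⊓ cubicPoint t : Subsp K) = ⊥ := by
    rw [cubicPoint, cubicPoint, ← disjoint_iff,
      Submodule.disjoint_span_singleton' (cubicVec_ne_zero t)]
    intro h
    refine hst (cubicPoint_injective ?_).symm
    refine Submodule.eq_of_le_of_finrank_eq ?_ (by rw [finrank_cubicPoint, finrank_cubicPoint])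
    rwa [cubicPoint, Submodule.span_singleton_le_iff_mem]
  have h := Submodule.finrank_sup_add_finrank_inf_eq (cubicPoint s) (cubicPoint t : Subsp K)
  rwa [hinf, finrank_bot, finrank_cubicPoint, finrank_cubicPoint, add_zero] at h

end Extension

/-! ### Chords, axes and tangents -/

section Lines

variable {F : Type*} [Field F]

theorem isStable_realChords : IsStable (realChords F) := by
  rintro φ hφ _ ⟨s, t, hst, rfl⟩
  obtain ⟨s', hs'⟩ := exists_map_cubicPoint hφ s
  obtain ⟨t', ht'⟩ := exists_map_cubicPoint hφ t
  refine ⟨s', t', ?_, by rw [OrderIso.map_sup, hs', ht']⟩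
  rintro rfl
  exact hst (cubicPoint_injective (φ.injective (hs'.trans ht'.symm)))

theorem nullPolarity_image_realChords : nullPolarity '' realChords F = realAxes F := by
  ext W
  constructor
  · rintro ⟨_, ⟨s, t, hst, rfl⟩, rfl⟩
    exact ⟨s, t, hst, by rw [nullPolarity_sup, nullPolarity_cubicPoint, nullPolarity_cubicPoint]⟩
  · rintro ⟨s, t, hst, rfl⟩
    exact ⟨_, ⟨s, t, hst, rfl⟩,
      by rw [nullPolarity_sup, nullPolarity_cubicPoint, nullPolarity_cubicPoint]⟩

theorem nullPolarity_image_realAxes (h3 : (3 : F) ≠ 0) :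
    nullPolarity '' realAxes F = realChords F := by
  rw [← nullPolarity_image_realChords, image_image_nullPolarity h3]

theorem finrank_tangentLine (t : Option F) : finrank F (tangentLine t) = 2 := by
  cases t with
  | none =>
    have h : LinearIndependent F ![(![1, 0, 0, 0] : Fin 4 → F), ![0, 1, 0, 0]] := by
      rw [LinearIndependent.pair_iff]
      intro a b hab
      exact ⟨by simpa using congrFun hab 0, by simpa using congrFun hab 1⟩
    have := finrank_span_eq_card h
    rwa [Matrix.range_cons_cons_empty, Fintype.card_fin] at this
  | some t =>
    have h : LinearIndependent F ![(![t ^ 3, t ^ 2, t, 1] : Fin 4 → F),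
        ![3 * t ^ 2, 2 * t, 1, 0]] := by
      rw [LinearIndependent.pair_iff]
      intro a b hab
      have ha : a = 0 := by simpa using congrFun hab 3
      exact ⟨ha, by simpa [ha] using congrFun hab 2⟩
    have := finrank_span_eq_card h
    rwa [Matrix.range_cons_cons_empty, Fintype.card_fin] at this

theorem nullPolarity_tangentLine (h3 : (3 : F) ≠ 0) (t : Option F) :
    nullPolarity (tangentLine t) = tangentLine t := by
  refine nullPolarity_eq_self h3 (finrank_tangentLine t) (cubicVec_ne_zero t) ?_ ?_
  · cases t <;> exact Submodule.subset_span (Set.mem_insert _ _)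
  · cases t with
    | none =>
      rw [tangentLine, Submodule.span_le, Set.pair_subset_iff]
      constructor <;>
      · rw [SetLike.mem_coe, nullPolarity_span_singleton, nullForm_apply]
        simp [cubicVec]
    | some t =>
      rw [tangentLine, Submodule.span_le, Set.pair_subset_iff]
      constructor <;>
      · rw [SetLike.mem_coe, nullPolarity_span_singleton, nullForm_apply]
        simp [cubicVec]
        ring

theorem nullPolarity_image_tangents (h3 : (3 : F) ≠ 0) :
    nullPolarity '' tangents F = tangents F := by
  rw [tangents, ← Set.range_comp]
  congr 1
  exact funext (nullPolarity_tangentLine h3)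

theorem nullPolarity_image_imaginaryChords (h3 : (3 : F) ≠ 0) :
    nullPolarity '' imaginaryChords F = imaginaryAxes F := by
  have h3L := three_ne_zero_of_algebra (AlgebraicClosure F) h3
  ext W
  rw [mem_image_nullPolarity h3]
  refine and_congr (finrank_nullPolarity_eq h3 rfl) (exists_congr fun t => and_congr_right
    fun _ => ?_)
  rw [extendScalars_nullPolarity h3, ← (nullPolarity_injective h3L).eq_iff,
    nullPolarity_nullPolarity h3L, nullPolarity_sup, nullPolarity_cubicPoint,
    nullPolarity_cubicPoint]

theorem nullPolarity_image_imaginaryAxes (h3 : (3 : F) ≠ 0) :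
    nullPolarity '' imaginaryAxes F = imaginaryChords F := by
  rw [← nullPolarity_image_imaginaryChords h3, image_image_nullPolarity h3]

theorem nullPolarity_mem_imaginaryChords (h3 : (3 : F) ≠ 0) {W : Subsp F} :
    nullPolarity W ∈ imaginaryChords F ↔ W ∈ imaginaryAxes F := by
  rw [← nullPolarity_image_imaginaryChords h3, mem_image_nullPolarity h3]

theorem nullPolarity_mem_imaginaryAxes (h3 : (3 : F) ≠ 0) {W : Subsp F} :
    nullPolarity W ∈ imaginaryAxes F ↔ W ∈ imaginaryChords F := by
  rw [← nullPolarity_image_imaginaryAxes h3, mem_image_nullPolarity h3]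

variable [Finite F]

theorem algebraMap_ne_of_isImaginary {t : AlgebraicClosure F} (ht : IsImaginary t) (s : F) :
    algebraMap F (AlgebraicClosure F) s ≠ t := by
  rintro rfl
  refine ht.2 ?_
  have := algebraMap_pow_card (L := AlgebraicClosure F) s 1
  rwa [pow_one] at this

theorem isStable_imaginaryChords (hq : 5 ≤ Nat.card F) : IsStable (imaginaryChords F) := by
  rintro φ hφ W ⟨hW, t, ht, hWt⟩
  refine ⟨(finrank_map hφ W).trans hW, ?_⟩
  obtain ⟨a, b, c, d, h, rfl⟩ := exists_eq_symCubeIso hq hφ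
  set ι := algebraMap F (AlgebraicClosure F) with hι
  have hdet : ι a * ι d - ι b * ι c ≠ 0 := by
    simpa using ι.injective.ne h
  have hden : ι c * t + ι d ≠ 0 := by
    intro h0
    by_cases hc : c = 0
    · have hd : d = 0 := by simpa [hc] using h0
      exact h (by rw [hc, hd]; ring)
    · refine algebraMap_ne_of_isImaginary ht (-d / c) ?_
      rw [map_div₀, map_neg, div_eq_iff (by simpa using hc)]
      linear_combination -h0
  -- Frobenius commutes with the fractional linear map
  have frob : ∀ n, ((ι a * t + ι b) / (ι c * t + ι d)) ^ (Nat.card F ^ n) =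
      (ι a * t ^ (Nat.card F ^ n) + ι b) / (ι c * t ^ (Nat.card F ^ n) + ι d) := by
    intro n
    rw [div_pow, add_pow_card (F := F), add_pow_card (F := F), mul_pow, mul_pow]
    simp only [hι, algebraMap_pow_card]
  have frob1 := frob 1
  rw [pow_one] at frob1
  have hden1 : ι c * t ^ Nat.card F + ι d ≠ 0 := by
    have e : (ι c * t + ι d) ^ (Nat.card F ^ 1) = ι c * t ^ (Nat.card F ^ 1) + ι d := by
      rw [add_pow_card (F := F), mul_pow]
      simp only [hι, algebraMap_pow_card]
    rw [pow_one] at e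
    rw [← e]
    exact pow_ne_zero _ hden
  refine ⟨(ι a * t + ι b) / (ι c * t + ι d), ⟨?_, ?_⟩, ?_⟩
  · rw [frob 2, ht.1]
  · rw [frob1, Ne, div_eq_div_iff hden1 hden]
    intro heq
    have : (ι a * ι d - ι b * ι c) * (t ^ Nat.card F - t) = 0 := by linear_combination heq
    rw [mul_eq_zero, or_iff_right hdet, sub_eq_zero] at this
    exact ht.2 this
  · rw [symCubeIso_apply, extendScalars_map_symCube, hWt, ← symCubeIso_apply _ _ _ _ hdet,
      OrderIso.map_sup, frob1]
    have key : ∀ s : AlgebraicClosure F, ι c * s + ι d ≠ 0 →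
        symCubeIso (ι a) (ι b) (ι c) (ι d) hdet (cubicPoint (some s)) =
          cubicPoint (some ((ι a * s + ι b) / (ι c * s + ι d))) := by
      intro s hs
      have := symCubeIso_cubicPoint hdet (u := s) (v := 1) (by simp)
      rw [mul_one, mul_one, param_of_ne one_ne_zero, div_one, param_of_ne hs] at this
      exact this
    rw [key t hden, key _ hden1]

theorem inΓPlane_iff (W : Subsp F) : InΓPlane W ↔ numAbove (developable F) W ≠ 0 := by
  have hfin : {U ∈ developable F | W ≤ U}.Finite :=
    (Set.finite_range oscPlane).subset (Set.sep_subset _ _)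
  rw [numAbove, Ne, Set.ncard_eq_zero hfin, ← Ne, ← Set.nonempty_iff_ne_empty]
  rfl

theorem notMem_imaginaryChords_of_cubicPoint_le {W : Subsp F} {s : Option F}
    (hs : cubicPoint s ≤ W) : W ∉ imaginaryChords F := by
  rintro ⟨-, t, ht, h⟩
  have hle := cubicPoint_le_extendScalars (K := AlgebraicClosure F) hs
  rw [h] at hle
  have hne : ∀ r, (∀ x, algebraMap F (AlgebraicClosure F) x ≠ r) →
      s.map (algebraMap F (AlgebraicClosure F)) ≠ some r := by
    intro r hr hsr
    obtain ⟨x, -, hx⟩ := Option.map_eq_some_iff.1 hsr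
    exact hr x hx
  refine not_cubicPoint_le_sup (hne _ (algebraMap_ne_of_isImaginary ht)) (hne _ fun x hx => ?_)
    (fun h => ht.2 (Option.some_injective _ h).symm) hle
  -- the conjugate of `t` is not in `F` either, since its conjugate is `t`
  refine algebraMap_ne_of_isImaginary ht x ?_
  have h1 := algebraMap_pow_card (L := AlgebraicClosure F) x 1
  have h2 := ht.1
  rw [pow_one] at h1
  rw [pow_two, pow_mul, ← hx, h1] at h2
  exact h2

theorem notMem_imaginaryChords_of_le_oscPlane {W : Subsp F} {s : Option F}
    (hs : W ≤ oscPlane s) : W ∉ imaginaryChords F := by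
  rintro ⟨-, t, ht, h⟩
  have hle := (extendScalars_mono hs).trans
    (extendScalars_oscPlane_le (K := AlgebraicClosure F) s)
  rw [h] at hle
  have heq := (cubicPoint_le_oscPlane _ _).1 (le_sup_left.trans hle)
  obtain ⟨x, -, hx⟩ := Option.map_eq_some_iff.1 heq.symm
  exact algebraMap_ne_of_isImaginary ht x hx

theorem exists_cubicPoint_le {W : Subsp F} (h : numBelow (cubic F) W ≠ 0) :
    ∃ t, cubicPoint t ≤ W := by
  rw [numBelow_cubic, Ne, Set.ncard_eq_zero, ← Ne, ← Set.nonempty_iff_ne_empty] at h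
  exact h

theorem exists_le_oscPlane {W : Subsp F} (h : numAbove (developable F) W ≠ 0) :
    ∃ t, W ≤ oscPlane t := by
  rw [numAbove_developable, Ne, Set.ncard_eq_zero, ← Ne, ← Set.nonempty_iff_ne_empty] at h
  exact h

theorem mem_realAxes_iff (h3 : (3 : F) ≠ 0) {W : Subsp F} (hW : finrank F W = 2) :
    W ∈ realAxes F ↔ 2 ≤ numAbove (developable F) W := by
  rw [numAbove_developable, ← Nat.lt_iff_add_one_le, Set.one_lt_ncard]
  constructor
  · rintro ⟨s, t, hst, rfl⟩
    exact ⟨s, (inf_le_left : oscPlane s ⊓ oscPlane t ≤ _), t,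
      (inf_le_right : oscPlane s ⊓ oscPlane t ≤ _), hst⟩
  · rintro ⟨s, hs, t, ht, hst⟩
    refine ⟨s, t, hst, Submodule.eq_of_le_of_finrank_eq (le_inf hs ht) ?_⟩
    rw [hW, ← nullPolarity_cubicPoint, ← nullPolarity_cubicPoint, ← nullPolarity_sup,
      finrank_nullPolarity h3, finrank_cubicPoint_sup hst]

/-! ### Duality of line classes -/

theorem linesOfType_UnΓ : linesOfType F .UnΓ =
    {ℓ : Subsp F | finrank F ℓ = 2 ∧ numBelow (cubic F) ℓ = 1 ∧
      numAbove (developable F) ℓ = 0} := by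
  ext W
  change _ ∧ _ ∧ ¬ InΓPlane W ↔ _
  rw [inΓPlane_iff, not_not]
  rfl

/-- Among the external lines in an osculating plane, the class `EΓ` consists of those in only one
such plane: a line in two of them is a real axis, and a line in exactly one is neither an imaginary
chord nor an imaginary axis. -/
theorem linesOfType_EΓ (h3 : (3 : F) ≠ 0) : linesOfType F .EΓ =
    {ℓ : Subsp F | finrank F ℓ = 2 ∧ numAbove (developable F) ℓ = 1 ∧
      numBelow (cubic F) ℓ = 0} := by
  ext W
  constructor
  · rintro ⟨h2, h0, -, hRA, -, hΓ⟩
    rw [inΓPlane_iff] at hΓ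
    rw [mem_realAxes_iff h3 h2] at hRA
    exact ⟨h2, by omega, h0⟩
  · rintro ⟨h2, h1, h0⟩
    refine ⟨h2, h0, ?_, ?_, ?_, ?_⟩
    · obtain ⟨s, hs⟩ := exists_le_oscPlane (W := W) (by omega)
      exact notMem_imaginaryChords_of_le_oscPlane hs
    · rw [mem_realAxes_iff h3 h2]; omega
    · rw [← numBelow_cubic_nullPolarity h3] at h1
      obtain ⟨s, hs⟩ := exists_cubicPoint_le (W := nullPolarity W) (by omega)
      rw [← nullPolarity_mem_imaginaryChords h3]
      exact notMem_imaginaryChords_of_cubicPoint_le hs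
    · rw [inΓPlane_iff]; omega

theorem linesOfType_EnΓ (h3 : (3 : F) ≠ 0) : linesOfType F .EnΓ =
    {ℓ : Subsp F | finrank F ℓ = 2 ∧ numBelow (cubic F) ℓ = 0 ∧ numAbove (developable F) ℓ = 0 ∧
      ℓ ∉ imaginaryChords F ∧ ℓ ∉ imaginaryAxes F} := by
  ext W
  constructor
  · rintro ⟨h2, h0, hIC, -, hIA, hΓ⟩
    rw [inΓPlane_iff, not_not] at hΓ
    exact ⟨h2, h0, hΓ, hIC, hIA⟩
  · rintro ⟨h2, h0, hΓ, hIC, hIA⟩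
    refine ⟨h2, h0, hIC, ?_, hIA, ?_⟩
    · rw [mem_realAxes_iff h3 h2]; omega
    · rw [inΓPlane_iff]; omega

theorem linesOfType_UΓ : linesOfType F .UΓ =
    {ℓ : Subsp F | finrank F ℓ = 2 ∧ numBelow (cubic F) ℓ = 1 ∧ ℓ ∉ tangents F ∧
      numAbove (developable F) ℓ ≠ 0} := by
  ext W
  change _ ∧ _ ∧ _ ∧ InΓPlane W ↔ _
  rw [inΓPlane_iff]
  rfl

/-- A line through a point of the cubic and in an osculating plane lies in the polar plane of that
point, and so is self-polar. -/
theorem nullPolarity_eq_self_of_mem_UΓ (h3 : (3 : F) ≠ 0) {W : Subsp F}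
    (hW : W ∈ linesOfType F .UΓ) : nullPolarity W = W := by
  rw [linesOfType_UΓ] at hW
  obtain ⟨h2, h1, -, hΓ⟩ := hW
  obtain ⟨t, ht⟩ := exists_cubicPoint_le (W := W) (by omega)
  obtain ⟨s, hs⟩ := exists_le_oscPlane hΓ
  obtain rfl := (cubicPoint_le_oscPlane t s).1 (ht.trans hs)
  refine nullPolarity_eq_self h3 h2 (cubicVec_ne_zero t)
    ((Submodule.span_singleton_le_iff_mem _ _).1 ht) ?_
  rwa [← nullPolarity_cubicPoint] at hs

theorem isStable_linesOfType (hq : 5 ≤ Nat.card F) (h3 : (3 : F) ≠ 0) (l : LineType) :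
    IsStable (linesOfType F l) := by
  have hB := fun {φ : Subsp F ≃o Subsp F} (hφ : φ ∈ cubicGroup F) (W : Subsp F) =>
    isStable_cubic.numBelow_map hφ W
  have hA := fun {φ : Subsp F ≃o Subsp F} (hφ : φ ∈ cubicGroup F) (W : Subsp F) =>
    (isStable_developable hq).numAbove_map hφ W
  have hIC := isStable_imaginaryChords hq
  have hIA : IsStable (imaginaryAxes F) :=
    nullPolarity_image_imaginaryChords h3 ▸ isStable_image_nullPolarity hq hIC
  cases l with
  | RC => exact isStable_realChords
  | RA =>
    change IsStable (realAxes F)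
    rw [← nullPolarity_image_realChords]
    exact isStable_image_nullPolarity hq isStable_realChords
  | T => exact isStable_tangents hq h3
  | IC => exact hIC
  | IA => exact hIA
  | UΓ =>
    rw [linesOfType_UΓ]
    rintro φ hφ W ⟨h2, h1, hT, hΓ⟩
    exact ⟨(finrank_map hφ W).trans h2, (hB hφ W).trans h1,
      fun h => hT (((isStable_tangents hq h3).map_mem_iff hφ).1 h), by rwa [hA hφ]⟩
  | UnΓ =>
    rw [linesOfType_UnΓ]
    rintro φ hφ W ⟨h2, h1, hΓ⟩
    exact ⟨(finrank_map hφ W).trans h2, (hB hφ W).trans h1, (hA hφ W).trans hΓ⟩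
  | EΓ =>
    rw [linesOfType_EΓ h3]
    rintro φ hφ W ⟨h2, hΓ, h0⟩
    exact ⟨(finrank_map hφ W).trans h2, (hA hφ W).trans hΓ, (hB hφ W).trans h0⟩
  | EnΓ =>
    rw [linesOfType_EnΓ h3]
    rintro φ hφ W ⟨h2, h0, hΓ, h4, h5⟩
    exact ⟨(finrank_map hφ W).trans h2, (hB hφ W).trans h0, (hA hφ W).trans hΓ,
      fun h => h4 ((hIC.map_mem_iff hφ).1 h), fun h => h5 ((hIA.map_mem_iff hφ).1 h)⟩

theorem image_linesOfType (h3 : (3 : F) ≠ 0) (l : LineType) :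
    nullPolarity '' linesOfType F l = linesOfType F (dualLineType l) := by
  have hUE : nullPolarity '' linesOfType F .UnΓ = linesOfType F .EΓ := by
    ext W
    rw [mem_image_nullPolarity h3, linesOfType_UnΓ, linesOfType_EΓ h3]
    change finrank F (nullPolarity W) = 2 ∧ numBelow (cubic F) (nullPolarity W) = 1 ∧
      numAbove (developable F) (nullPolarity W) = 0 ↔ _
    rw [finrank_nullPolarity_eq h3 (l := 2) rfl, numBelow_cubic_nullPolarity h3,
      numAbove_developable_nullPolarity h3]
    rfl
  cases l with
  | RC => exact nullPolarity_image_realChords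
  | RA => exact nullPolarity_image_realAxes h3
  | T => exact nullPolarity_image_tangents h3
  | IC => exact nullPolarity_image_imaginaryChords h3
  | IA => exact nullPolarity_image_imaginaryAxes h3
  | UΓ =>
    change nullPolarity '' linesOfType F .UΓ = linesOfType F .UΓ
    exact (Set.image_congr fun W hW => nullPolarity_eq_self_of_mem_UΓ h3 hW).trans
      (Set.image_id' _)
  | UnΓ => exact hUE
  | EΓ =>
    change nullPolarity '' linesOfType F .EΓ = linesOfType F .UnΓ
    rw [← hUE, image_image_nullPolarity h3]
  | EnΓ =>
    change nullPolarity '' linesOfType F .EnΓ = linesOfType F .EnΓ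
    ext W
    rw [mem_image_nullPolarity h3, linesOfType_EnΓ h3]
    change finrank F (nullPolarity W) = 2 ∧ numBelow (cubic F) (nullPolarity W) = 0 ∧
      numAbove (developable F) (nullPolarity W) = 0 ∧ nullPolarity W ∉ imaginaryChords F ∧
        nullPolarity W ∉ imaginaryAxes F ↔ finrank F W = 2 ∧ numBelow (cubic F) W = 0 ∧
      numAbove (developable F) W = 0 ∧ W ∉ imaginaryChords F ∧ W ∉ imaginaryAxes F
    rw [finrank_nullPolarity_eq h3 (l := 2) rfl, numBelow_cubic_nullPolarity h3,
      numAbove_developable_nullPolarity h3, nullPolarity_mem_imaginaryChords h3,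
      nullPolarity_mem_imaginaryAxes h3]
    tauto

end Lines

/-! ### Equality of incidence numbers -/

section Counting

variable {F : Type*} [Field F]

theorem three_ne_zero_of_card [Finite F] (h : ¬ 3 ∣ Nat.card F) : (3 : F) ≠ 0 := by
  intro h3
  have := Fintype.ofFinite F
  obtain ⟨p, hp⟩ := CharP.exists F
  obtain ⟨k, hprime, hk⟩ := FiniteField.card F p
  have hdvd : p ∣ 3 := (CharP.cast_eq_zero_iff F p 3).1 (by exact_mod_cast h3)
  obtain rfl := (Nat.prime_dvd_prime_iff_eq hprime Nat.prime_three).1 hdvd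
  rw [Nat.card_eq_fintype_card, hk] at h
  exact h (dvd_pow_self _ k.ne_zero)

theorem numAbove_nullPolarity (h3 : (3 : F) ≠ 0) (S : Set (Subsp F)) (W : Subsp F) :
    numAbove (nullPolarity '' S) (nullPolarity W) = numBelow S W := by
  rw [← numBelow_nullPolarity h3 (nullPolarity '' S), image_image_nullPolarity h3,
    nullPolarity_nullPolarity h3]

theorem avgPointsOn_eq (h3 : (3 : F) ≠ 0) (M O : Set (Subsp F)) :
    avgPointsOn M O = avgPlanesThrough (nullPolarity '' M) (nullPolarity '' O) := by
  rw [avgPointsOn, avgPlanesThrough, finsum_mem_image (nullPolarity_injective h3).injOn,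
    Set.ncard_image_of_injective _ (nullPolarity_injective h3)]
  simp only [numAbove_nullPolarity h3]

/-- The number of members of a stable set through a point of an orbit is the same for all points
of the orbit, and equals the number of members of the polar set in a plane of the polar orbit. -/
theorem numAbove_eq_numBelow_of_isOrbit (h3 : (3 : F) ≠ 0)
    {k : ℕ} {M O : Set (Subsp F)} (hM : IsOrbit k M) (hO : IsStable O) {x y : Subsp F}
    (hx : x ∈ M) (hy : y ∈ nullPolarity '' M) :
    numAbove O x = numBelow (nullPolarity '' O) y := by
  obtain ⟨z, hz, rfl⟩ := hy
  obtain ⟨φ, hφ, rfl⟩ := hM.cubicEquiv hx hz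
  rw [numBelow_nullPolarity h3, hO.numAbove_map hφ]

/-- The number of members of a stable set on a line of an orbit is the same for all lines of the
orbit, and equals the number of members of the polar set through a line of the polar orbit. -/
theorem numBelow_eq_numAbove_of_isOrbit (h3 : (3 : F) ≠ 0)
    {k : ℕ} {M S : Set (Subsp F)} (hS : IsOrbit k S) (hM : IsStable M) {a b : Subsp F}
    (ha : a ∈ S) (hb : b ∈ nullPolarity '' S) :
    numBelow M a = numAbove (nullPolarity '' M) b := by
  obtain ⟨z, hz, rfl⟩ := hb
  obtain ⟨φ, hφ, rfl⟩ := hS.cubicEquiv ha hz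
  rw [numAbove_nullPolarity h3, hM.numBelow_map hφ]

end Counting

end TwistedCubic

theorem mainTheorem2 {F : Type*} [Field F] [Finite F]
    (hq : 5 ≤ Nat.card F) (h3 : ¬ 3 ∣ Nat.card F) :
    -- the null polarity sends point orbits to plane orbits, and line orbits to line orbits
    (∀ S : Set (Subsp F), IsOrbit 1 S → IsOrbit 3 (nullPolarity '' S)) ∧
    (∀ S : Set (Subsp F), IsOrbit 2 S → IsOrbit 2 (nullPolarity '' S)) ∧
    -- the correspondence of point types and plane types
    nullPolarity '' pointsOfType F .C = planesOfType F .Γ ∧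
    nullPolarity '' pointsOfType F .T = planesOfType F .twoC ∧
    nullPolarity '' pointsOfType F .threeΓ = planesOfType F .threeC ∧
    nullPolarity '' pointsOfType F .oneΓ = planesOfType F .oneC ∧
    nullPolarity '' pointsOfType F .zeroΓ = planesOfType F .zeroC ∧
    -- the correspondence of line types, for classes and for the orbits in them
    (∀ l : LineType,
      (∀ S : Set (Subsp F), IsOrbit 2 S → (S ∩ linesOfType F l).Nonempty → S ⊆ linesOfType F l) ∧
      nullPolarity '' linesOfType F l = linesOfType F (dualLineType l)) ∧
    (∀ S : Set (Subsp F), IsOrbit 2 S → S ⊆ linesOfType F .UΓ → nullPolarity '' S = S) ∧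
    -- equality of the point-line and the plane-line incidence numbers
    (∀ (k : PointType) (p : PlaneType),
      nullPolarity '' pointsOfType F k = planesOfType F p →
      IsOrbit 1 (pointsOfType F k) ∧ IsOrbit 3 (planesOfType F p) ∧
      ∀ l : LineType,
        avgPointsOn (pointsOfType F k) (linesOfType F l) =
          avgPlanesThrough (planesOfType F p) (linesOfType F (dualLineType l)) ∧
        (∀ x ∈ pointsOfType F k, ∀ y ∈ planesOfType F p,
          numAbove (linesOfType F l) x = numBelow (linesOfType F (dualLineType l)) y) ∧
        ∀ S : Set (Subsp F), IsOrbit 2 S → S ⊆ linesOfType F l →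
          nullPolarity '' S ⊆ linesOfType F (dualLineType l) ∧
          (∀ a ∈ S, ∀ b ∈ nullPolarity '' S,
            numBelow (pointsOfType F k) a = numAbove (planesOfType F p) b) ∧
          (∀ x ∈ pointsOfType F k, ∀ y ∈ planesOfType F p,
            numAbove S x = numBelow (nullPolarity '' S) y)) := by
  have h3F := three_ne_zero_of_card h3
  refine ⟨fun S hS => hS.image_nullPolarity hq h3F rfl,
    fun S hS => hS.image_nullPolarity hq h3F rfl,
    nullPolarity_image_cubic, ?_, image_pointsOn_of_ne h3F (by norm_num), image_pointsOn h3F 1,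
    image_pointsOn_of_ne h3F (by norm_num), fun l => ⟨fun S hS hne => ?_, image_linesOfType h3F l⟩,
    fun S _ hS => ?_, ?_⟩
  · rw [pointsOfType_T hq h3F]
    exact image_pointsOn_of_ne h3F (by norm_num)
  · obtain ⟨W, hWS, hWl⟩ := hne
    intro U hU
    obtain ⟨φ, hφ, rfl⟩ := hS.cubicEquiv hWS hU
    exact isStable_linesOfType hq h3F l φ hφ W hWl
  · exact (Set.image_congr fun W hW => nullPolarity_eq_self_of_mem_UΓ h3F (hS hW)).trans
      (Set.image_id' _)
  · intro k p hkp
    obtain ⟨M, hM, hMp⟩ := exists_isOrbit_image_eq_planesOfType hq h3F p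
    -- the polarity is injective, so the point type is the orbit `M`
    obtain rfl : M = pointsOfType F k :=
      (nullPolarity_injective h3F).image_injective (hMp.trans hkp.symm)
    rw [← hkp]
    refine ⟨hM, hM.image_nullPolarity hq h3F rfl, fun l => ?_⟩
    rw [← image_linesOfType h3F l]
    exact ⟨avgPointsOn_eq h3F _ _,
      fun x hx y hy => numAbove_eq_numBelow_of_isOrbit h3F hM
        (isStable_linesOfType hq h3F l) hx hy,
      fun S hS hSl => ⟨Set.image_mono hSl,
        fun a ha b hb => numBelow_eq_numAbove_of_isOrbit h3F hS hM.isStable ha hb,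
        fun x hx y hy => numAbove_eq_numBelow_of_isOrbit h3F hM hS.isStable hx hy⟩⟩
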